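/- Let $L_0,L_1,\dots$ be the shifted, normalized Legendre polynomials on $[0,1]$ (the Gram--Schmidt orthonormalization of $1,x,x^2,\dots$ in $L^2([0,1])$), and for $S\subset[0,1]^2$ let $\lambda_{kl}(S)=\int_S L_k(x_1)L_l(x_2)\,d(x_1,x_2)$. Let $K\subset[0,1]^2$ be a convex body (compact, convex, with nonempty interior), and let $\delta(K,P)$ denote the Nikodym distance, i.e. the area of $(K\setminus P)\cup(P\setminus K)$. Let $(\theta_i)_{i\ge 1}$ be a dense sequence of pairwise distinct points of $[0,2\pi)$ with $(\theta_1,\theta_2,\theta_3,\theta_4)=(0,\frac{\pi}{2},\pi,\frac{3\pi}{2})$, and let $u_i=(\cos\theta_i,\sin\theta_i)$. For $h\in\mathbb{R}^n$ put $P(h)=\bigcap_{i=1}^n\{x\in\mathbb{R}^2:\langle x,u_i\rangle\le h_i\}$, and let $\mathcal{P}_n$ be the set of all polygons $P(h)\subset[0,1]^2$ such that $h$ is consistent, i.e. such that the support function of $P(h)$ has the value $h_i$ in the direction $u_i$ for $1\le i\le n$. For every $N\in\mathbb{N}_0$ let $\epsilon_{Nkl}$, $0\le k,l\le N$, be real random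 variables with mean zero and finite variance at most $\sigma_N^2$, all defined on one probability space (no independence is assumed), and let $\tilde\lambda_{kl}=\lambda_{kl}(K)+\epsilon_{Nkl}$ be the noisy measurements. Let $\mathcal{S}_{n,N}$ be the random set of least squares estimators, i.e. of all $P\in\mathcal{P}_n$ that minimize $\sum_{k,l=0}^N(\tilde\lambda_{kl}-\lambda_{kl}(P))^2$ over $\mathcal{P}_n$, and let $D_{n,N}=\sup_{P\in\mathcal{S}_{n,N}}\delta(K,P)$. Then for all $n\ge4$ and $N\ge0$ the set $\mathcal{S}_{n,N}$ is nonempty and $D_{n,N}$ is a random variable (measurable), and the following hold. (i) If $\sigma_N^2=\mathcal{O}(N^{-(2+\varepsilon)})$ as $N\to\infty$ for some $\varepsilon>0$, then $D_{n,N}$ is integrable for all $n\ge4$ and $N\ge0$, and $D_{n,N}\to0$ in mean and in probability as $n,N\to\infty$ (jointly). (ii) If $\sigma_N^2=\mathcal{O}(N^{-(3+\varepsilon)})$ as $N\to\infty$ for some $\varepsilon>0$, then almost surely $D_{n,N}\to0$ as $n,N\to\infty$ (jointly). -/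

import Mathlib

open MeasureTheory ProbabilityTheory Filter Topology Polynomial Asymptotics

namespace LegendreRecon

noncomputable section

/-! ### Legendre polynomials and Legendre moments -/

/-- The inner product `⟨p, q⟩ = ∫₀¹ p(x) q(x) dx` of `L²([0,1])` on the space of real polynomials. -/
@[reducible] def polyInnerCore : InnerProductSpace.Core ℝ ℝ[X] where
  inner p q := ∫ x in (0 : ℝ)..1, p.eval x * q.eval x
  conj_inner_symm p q := by simp [mul_comm]
  re_inner_nonneg p := by
    have : 0 ≤ ∫ x in (0 : ℝ)..1, p.eval x * p.eval x :=
      intervalIntegral.integral_nonneg zero_le_one fun x _ => mul_self_nonneg _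
    simpa using this
  add_left p q r := by
    simp only [eval_add, add_mul]
    exact intervalIntegral.integral_add
      ((p.continuous.mul r.continuous).intervalIntegrable _ _)
      ((q.continuous.mul r.continuous).intervalIntegrable _ _)
  smul_left p q c := by
    simp [mul_assoc]
  definite p hp := by
    by_contra hne
    have hfin : {x : ℝ | p.eval x = 0}.Finite := by
      refine (p.roots.toFinset.finite_toSet).subset fun x hx => ?_
      simpa [hne] using hx
    obtain ⟨c, hc, hpc⟩ : ∃ c ∈ Set.Icc (0 : ℝ) 1, p.eval c ≠ 0 := by
      by_contra! hall
      exact (Set.Icc_infinite (zero_lt_one (α := ℝ))) (hfin.subset fun x hx => hall x hx)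
    have hpos : 0 < ∫ x in (0 : ℝ)..1, p.eval x * p.eval x :=
      intervalIntegral.integral_pos zero_lt_one
        (p.continuous.mul p.continuous).continuousOn
        (fun x _ => mul_self_nonneg _) ⟨c, hc, mul_self_pos.mpr hpc⟩
    exact hpos.ne' hp

/-- The shifted and normalized Legendre polynomials `L₀, L₁, …`: the Gram–Schmidt
orthonormalization of `1, x, x², …` with respect to the inner product of `L²([0,1])`. -/
def legendre (i : ℕ) : ℝ[X] :=
  letI : NormedAddCommGroup ℝ[X] := polyInnerCore.toNormedAddCommGroup
  letI : InnerProductSpace ℝ ℝ[X] := InnerProductSpace.ofCore polyInnerCore.toCore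
  InnerProductSpace.gramSchmidtNormed ℝ (fun k : ℕ => (X : ℝ[X]) ^ k) i

/-- The Legendre moment `λ_{kl}(S) = ∫_S L_k(x₁) L_l(x₂) d(x₁,x₂)` of a planar set. -/
def legendreMoment (k l : ℕ) (S : Set (ℝ × ℝ)) : ℝ :=
  ∫ x in S, (legendre k).eval x.1 * (legendre l).eval x.2

/-! ### Planar sets -/

/-- The unit square `[0,1]²`. -/
def unitSquare : Set (ℝ × ℝ) := Set.Icc 0 1 ×ˢ Set.Icc 0 1

/-- Convex bodies in the plane: compact convex sets with nonempty interior. -/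
def IsConvexBody (K : Set (ℝ × ℝ)) : Prop :=
  IsCompact K ∧ Convex ℝ K ∧ (interior K).Nonempty

/-- The Nikodym distance: the area of the symmetric difference. -/
def nikodym (K L : Set (ℝ × ℝ)) : ℝ := volume.real ((K \ L) ∪ (L \ K))

/-- The Euclidean inner product of `x` with the unit vector `(cos t, sin t)`. -/
def dirInner (t : ℝ) (x : ℝ × ℝ) : ℝ := x.1 * Real.cos t + x.2 * Real.sin t

/-- `P(h₁, …, hₙ)`: the intersection of the half-planes `⟨x, uᵢ⟩ ≤ hᵢ`, `uᵢ = (cos θᵢ, sin θᵢ)`. -/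
def polygon {n : ℕ} (θ h : Fin n → ℝ) : Set (ℝ × ℝ) :=
  {x | ∀ i, dirInner (θ i) x ≤ h i}

/-- `h` is consistent with respect to `θ`: the support function of `P(h₁, …, hₙ)` in the direction
`uᵢ` (the supremum of `⟨x, uᵢ⟩` over the polygon) has the value `hᵢ`, for every `i`. -/
def Consistent {n : ℕ} (θ h : Fin n → ℝ) : Prop :=
  ∀ i, IsLUB (dirInner (θ i) '' polygon θ h) (h i)

/-- `𝒫(θ₁, …, θₙ)`: the polygons `P(h₁, …, hₙ) ⊆ [0,1]²` with `h` consistent. The definition does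
not depend on the order in which the angles are listed. -/
def polygonClass {n : ℕ} (θ : Fin n → ℝ) : Set (Set (ℝ × ℝ)) :=
  {P | ∃ h : Fin n → ℝ, Consistent θ h ∧ P = polygon θ h ∧ P ⊆ unitSquare}

/-! ### Least squares estimators -/

/-- The least squares objective: the sum over `0 ≤ k, l ≤ N` of `(y_{kl} - λ_{kl}(P))²`. -/
def lsqObjective (N : ℕ) (y : ℕ → ℕ → ℝ) (P : Set (ℝ × ℝ)) : ℝ :=
  ∑ k ∈ Finset.range (N + 1), ∑ l ∈ Finset.range (N + 1), (y k l - legendreMoment k l P) ^ 2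

/-- The set of least squares estimators with respect to the measurements `y_{kl}`,
`0 ≤ k, l ≤ N`, on the space `𝒫(θ₁, …, θₙ)`. -/
def lsqEstimators {n : ℕ} (θ : Fin n → ℝ) (N : ℕ) (y : ℕ → ℕ → ℝ) : Set (Set (ℝ × ℝ)) :=
  {P | P ∈ polygonClass θ ∧ ∀ Q ∈ polygonClass θ, lsqObjective N y P ≤ lsqObjective N y Q}

/-- The noisy measurements `λ_{kl}(K) + e_{kl}`. -/
def noisyMoments (K : Set (ℝ × ℝ)) (e : ℕ → ℕ → ℝ) (k l : ℕ) : ℝ :=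
  legendreMoment k l K + e k l

/-- The supremum of `δ_N(K, P)` over all least squares estimators `P` of `K` on
`𝒫(θ₁, …, θₙ)` (the first `n` terms of the sequence `θ`) with respect to the noisy measurements of
the first `(N+1)²` Legendre moments. -/
def worstError (K : Set (ℝ × ℝ)) (θ : ℕ → ℝ) (n N : ℕ) (e : ℕ → ℕ → ℝ) : ℝ :=
  sSup (nikodym K '' lsqEstimators (fun i : Fin n => θ i) N (noisyMoments K e))

end

end LegendreRecon

open LegendreRecon

/-! Everything rests on one deterministic inequality: for N beyond a threshold depending only on ε,
`worstError` is at most 4 δ(K,Q) + 6 S + ε for every Q in the polygon class, where S is the sum of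
the squared errors (`exists_worstError_le`).

The Nikodym distance is the squared L² distance of indicators, so Bessel bounds the squared moment
differences by it. Conversely, the distance exceeds their truncated sum only by a tail, which is
controlled by the one-variable Legendre tails of horizontal and vertical slices
(`integral_sq_le_of_fourierTail_le`). Slices of compact convex sets are intervals or empty, and
Dini's theorem on the compact set of endpoint pairs makes their tails small uniformly
(`exists_fourierTail_indicator_Icc_le`). Comparing a minimizer with Q then gives the inequality.

For Q take the polygon circumscribed about K with the first n normals; density of the directions
gives δ(K,Q) → 0. By linearity E S ≤ (N+1)² σ_N², without independence. This tends to 0 in (i), and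
is summable in (ii), so that S → 0 almost surely. The terms in n and N are separate, hence the joint
limit.

Existence and measurability come from parametrizing the polygons by the compact set of tuples of
support points (`polygonClass_eq_image`), on which moments and distance are continuous. -/

namespace LegendreRecon

/-! ### Bounded measurable functions -/

/-- Bounded measurable real functions. -/
def BddMeasurable {α : Type*} [MeasurableSpace α] (f : α → ℝ) : Prop :=
  Measurable f ∧ ∃ C, ∀ x, |f x| ≤ C

namespace BddMeasurable

variable {α β : Type*} [MeasurableSpace α] [MeasurableSpace β] {f g : α → ℝ}

theorem integrable (hf : BddMeasurable f) (μ : Measure α) [IsFiniteMeasure μ] :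
    Integrable f μ := by
  obtain ⟨hm, C, hC⟩ := hf
  exact Integrable.of_bound hm.aestronglyMeasurable C (Eventually.of_forall hC)

theorem add (hf : BddMeasurable f) (hg : BddMeasurable g) :
    BddMeasurable fun x => f x + g x := by
  obtain ⟨hm, C, hC⟩ := hf
  obtain ⟨hm', C', hC'⟩ := hg
  exact ⟨hm.add hm', C + C', fun x => (abs_add_le _ _).trans (add_le_add (hC x) (hC' x))⟩

theorem sub (hf : BddMeasurable f) (hg : BddMeasurable g) :
    BddMeasurable fun x => f x - g x := by
  obtain ⟨hm, C, hC⟩ := hf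
  obtain ⟨hm', C', hC'⟩ := hg
  exact ⟨hm.sub hm', C + C', fun x => (abs_sub _ _).trans (add_le_add (hC x) (hC' x))⟩

theorem mul (hf : BddMeasurable f) (hg : BddMeasurable g) :
    BddMeasurable fun x => f x * g x := by
  obtain ⟨hm, C, hC⟩ := hf
  obtain ⟨hm', C', hC'⟩ := hg
  refine ⟨hm.mul hm', C * C', fun x => ?_⟩
  rw [abs_mul]
  exact mul_le_mul (hC x) (hC' x) (abs_nonneg _) ((abs_nonneg _).trans (hC x))

theorem const (c : ℝ) : BddMeasurable fun _ : α => c :=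
  ⟨measurable_const, |c|, fun _ => le_rfl⟩

theorem sq (hf : BddMeasurable f) : BddMeasurable fun x => f x ^ 2 := by
  simpa only [pow_two] using hf.mul hf

theorem sum {ι : Type*} (s : Finset ι) {F : ι → α → ℝ} (hF : ∀ i, BddMeasurable (F i)) :
    BddMeasurable fun x => ∑ i ∈ s, F i x := by
  classical
  induction s using Finset.induction_on with
  | empty => simpa using const (α := α) 0
  | insert a s ha ih => simpa [Finset.sum_insert ha] using (hF a).add ih

theorem comp {h : β → α} (hf : BddMeasurable f) (hh : Measurable h) :
    BddMeasurable fun x => f (h x) :=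
  ⟨hf.1.comp hh, hf.2.imp fun _ hC x => hC (h x)⟩

theorem indicator_one {s : Set α} (hs : MeasurableSet s) :
    BddMeasurable (s.indicator fun _ => (1 : ℝ)) := by
  refine ⟨measurable_const.indicator hs, 1, fun x => ?_⟩
  by_cases hx : x ∈ s <;> simp [hx]

theorem integral_right {F : α × β → ℝ} (hF : BddMeasurable F) (ν : Measure β)
    [IsProbabilityMeasure ν] : BddMeasurable fun x => ∫ y, F (x, y) ∂ν := by
  obtain ⟨hm, C, hC⟩ := hF
  refine ⟨(hm.stronglyMeasurable.integral_prod_right' (ν := ν)).measurable, C, fun x => ?_⟩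
  simpa using norm_integral_le_of_norm_le_const (μ := ν) (f := fun y => F (x, y))
    (Eventually.of_forall fun y => hC (x, y))

theorem swap {F : α × β → ℝ} (hF : BddMeasurable F) :
    BddMeasurable fun p : β × α => F (p.2, p.1) :=
  hF.comp (h := fun p : β × α => (p.2, p.1)) (by fun_prop)

end BddMeasurable

/-! ### Bessel's identity for bounded orthonormal systems -/

/-- A sequence of bounded measurable functions that is orthonormal in `L²(μ)`. -/
structure BddOrthonormal {α : Type*} [MeasurableSpace α] (μ : Measure α) (φ : ℕ → α → ℝ) :
    Prop where
  bdd : ∀ k, BddMeasurable (φ k)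
  ortho : ∀ k l, ∫ x, φ k x * φ l x ∂μ = if k = l then 1 else 0

section Bessel

variable {α : Type*} [MeasurableSpace α] {μ : Measure α} {φ : ℕ → α → ℝ}

/-- The `k`-th Fourier coefficient. -/
noncomputable def fourierCoef (μ : Measure α) (φ : ℕ → α → ℝ) (k : ℕ) (f : α → ℝ) : ℝ :=
  ∫ x, f x * φ k x ∂μ

/-- The squared `L²`-norm minus the sum of the first `n` squared Fourier coefficients. -/
noncomputable def fourierTail (μ : Measure α) (φ : ℕ → α → ℝ) (n : ℕ) (f : α → ℝ) : ℝ :=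
  ∫ x, f x ^ 2 ∂μ - ∑ k ∈ Finset.range n, fourierCoef μ φ k f ^ 2

/-- Orthonormality diagonalizes the expanded square, and completing the square in each `a k`
isolates the tail. Choosing the Fourier coefficients gives `fourierTail_eq`; dropping the last sum
gives best approximation, `fourierTail_le`. -/
theorem integral_sub_sum_sq [IsProbabilityMeasure μ] (hφ : BddOrthonormal μ φ) {f : α → ℝ}
    (hf : BddMeasurable f) (n : ℕ) (a : ℕ → ℝ) :
    ∫ x, (f x - ∑ k ∈ Finset.range n, a k * φ k x) ^ 2 ∂μ =
      fourierTail μ φ n f + ∑ k ∈ Finset.range n, (fourierCoef μ φ k f - a k) ^ 2 := by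
  have hfφ k : BddMeasurable fun x => f x * φ k x := hf.mul (hφ.bdd k)
  have hφφ k l : BddMeasurable fun x => φ k x * φ l x := (hφ.bdd k).mul (hφ.bdd l)
  have e : ∀ x, (f x - ∑ k ∈ Finset.range n, a k * φ k x) ^ 2 =
      f x ^ 2 - ∑ k ∈ Finset.range n, (2 * a k) * (f x * φ k x) +
      ∑ k ∈ Finset.range n, ∑ l ∈ Finset.range n, (a k * a l) * (φ k x * φ l x) := by
    intro x
    have e1 : ∑ k ∈ Finset.range n, (2 * a k) * (f x * φ k x) =
        2 * f x * ∑ k ∈ Finset.range n, a k * φ k x := by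
      rw [Finset.mul_sum]; exact Finset.sum_congr rfl fun k _ => by ring
    have e2 : ∑ k ∈ Finset.range n, ∑ l ∈ Finset.range n, (a k * a l) * (φ k x * φ l x) =
        (∑ k ∈ Finset.range n, a k * φ k x) * ∑ k ∈ Finset.range n, a k * φ k x := by
      rw [Finset.sum_mul_sum]
      exact Finset.sum_congr rfl fun k _ => Finset.sum_congr rfl fun l _ => by ring
    rw [e1, e2]; ring
  have h1 k : BddMeasurable fun x => (2 * a k) * (f x * φ k x) :=
    (BddMeasurable.const _).mul (hfφ k)
  have h2 k l : BddMeasurable fun x => (a k * a l) * (φ k x * φ l x) :=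
    (BddMeasurable.const _).mul (hφφ k l)
  have h3 k : BddMeasurable fun x => ∑ l ∈ Finset.range n, (a k * a l) * (φ k x * φ l x) :=
    BddMeasurable.sum _ (h2 k)
  simp_rw [e]
  rw [integral_add ((hf.sq.sub (.sum _ h1)).integrable μ) ((BddMeasurable.sum _ h3).integrable μ),
    integral_sub (hf.sq.integrable μ) ((BddMeasurable.sum _ h1).integrable μ),
    integral_finsetSum _ fun k _ => (h1 k).integrable μ,
    integral_finsetSum _ fun k _ => (h3 k).integrable μ]
  have e4 : ∀ k ∈ Finset.range n,
      ∫ x, ∑ l ∈ Finset.range n, (a k * a l) * (φ k x * φ l x) ∂μ = a k ^ 2 := by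
    intro k hk
    rw [integral_finsetSum _ fun l _ => (h2 k l).integrable μ]
    simp_rw [integral_const_mul, hφ.ortho]
    simp only [mul_ite, mul_one, mul_zero, Finset.sum_ite_eq, hk, if_true]
    ring
  rw [Finset.sum_congr rfl e4]
  simp_rw [integral_const_mul]
  unfold fourierTail fourierCoef
  rw [sub_add, sub_add, ← Finset.sum_sub_distrib, ← Finset.sum_sub_distrib]
  congr 1
  exact Finset.sum_congr rfl fun k _ => by ring

theorem fourierTail_eq [IsProbabilityMeasure μ] (hφ : BddOrthonormal μ φ) {f : α → ℝ}
    (hf : BddMeasurable f) (n : ℕ) :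
    fourierTail μ φ n f =
      ∫ x, (f x - ∑ k ∈ Finset.range n, fourierCoef μ φ k f * φ k x) ^ 2 ∂μ := by
  simp [integral_sub_sum_sq hφ hf]

theorem fourierTail_nonneg [IsProbabilityMeasure μ] (hφ : BddOrthonormal μ φ) {f : α → ℝ}
    (hf : BddMeasurable f) (n : ℕ) : 0 ≤ fourierTail μ φ n f := by
  rw [fourierTail_eq hφ hf]
  exact integral_nonneg fun x => sq_nonneg _

theorem fourierTail_le [IsProbabilityMeasure μ] (hφ : BddOrthonormal μ φ) {f : α → ℝ}
    (hf : BddMeasurable f) (n : ℕ) (a : ℕ → ℝ) :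
    fourierTail μ φ n f ≤ ∫ x, (f x - ∑ k ∈ Finset.range n, a k * φ k x) ^ 2 ∂μ := by
  rw [integral_sub_sum_sq hφ hf]
  exact le_add_of_nonneg_right (Finset.sum_nonneg fun k _ => sq_nonneg _)

theorem fourierTail_antitone (f : α → ℝ) : Antitone fun n => fourierTail μ φ n f := by
  refine antitone_nat_of_succ_le fun n => ?_
  simp only [fourierTail, Finset.sum_range_succ]
  nlinarith [sq_nonneg (fourierCoef μ φ n f)]

theorem fourierCoef_sub [IsProbabilityMeasure μ] (hφ : BddOrthonormal μ φ) {f g : α → ℝ}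
    (hf : BddMeasurable f) (hg : BddMeasurable g) (k : ℕ) :
    fourierCoef μ φ k (fun x => f x - g x) = fourierCoef μ φ k f - fourierCoef μ φ k g := by
  unfold fourierCoef
  simp_rw [sub_mul]
  exact integral_sub ((hf.mul (hφ.bdd k)).integrable μ) ((hg.mul (hφ.bdd k)).integrable μ)

/-- Remainders are linear in the function, so this is the integral of (a - b)² ≤ 2a² + 2b². It
reduces two bodies to one. -/
theorem fourierTail_sub_le [IsProbabilityMeasure μ] (hφ : BddOrthonormal μ φ) {f g : α → ℝ}
    (hf : BddMeasurable f) (hg : BddMeasurable g) (n : ℕ) :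
    fourierTail μ φ n (fun x => f x - g x) ≤
      2 * fourierTail μ φ n f + 2 * fourierTail μ φ n g := by
  have hr {f : α → ℝ} (hf : BddMeasurable f) : BddMeasurable fun x =>
      (f x - ∑ k ∈ Finset.range n, fourierCoef μ φ k f * φ k x) ^ 2 :=
    (hf.sub (.sum _ fun k => (BddMeasurable.const _).mul (hφ.bdd k))).sq
  rw [fourierTail_eq hφ hf, fourierTail_eq hφ hg, fourierTail_eq hφ (hf.sub hg),
    ← integral_const_mul, ← integral_const_mul,
    ← integral_add ((hr hf).integrable μ |>.const_mul 2) ((hr hg).integrable μ |>.const_mul 2)]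
  refine integral_mono ((hr (hf.sub hg)).integrable μ)
    (((hr hf).integrable μ |>.const_mul 2).add ((hr hg).integrable μ |>.const_mul 2)) fun x => ?_
  simp only [fourierCoef_sub hφ hf hg, sub_mul, Finset.sum_sub_distrib]
  nlinarith [sq_nonneg ((f x - ∑ k ∈ Finset.range n, fourierCoef μ φ k f * φ k x) +
    (g x - ∑ k ∈ Finset.range n, fourierCoef μ φ k g * φ k x))]

/-! ### Two variables -/

/-- The Fourier coefficient with respect to the product system. -/
noncomputable def fourierCoef₂ (μ : Measure α) (φ : ℕ → α → ℝ) (k l : ℕ) (F : α × α → ℝ) : ℝ :=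
  ∫ p, F p * (φ k p.1 * φ l p.2) ∂(μ.prod μ)

theorem BddOrthonormal.fourierCoef_fst [IsProbabilityMeasure μ] (hφ : BddOrthonormal μ φ)
    {F : α × α → ℝ} (hF : BddMeasurable F) (k : ℕ) :
    BddMeasurable fun y => fourierCoef μ φ k fun x => F (x, y) :=
  (hF.swap.mul ((hφ.bdd k).comp measurable_snd)).integral_right μ

theorem BddOrthonormal.fourierCoef_snd [IsProbabilityMeasure μ] (hφ : BddOrthonormal μ φ)
    {F : α × α → ℝ} (hF : BddMeasurable F) (k : ℕ) :
    BddMeasurable fun x => fourierCoef μ φ k fun y => F (x, y) :=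
  (hF.mul ((hφ.bdd k).comp measurable_snd)).integral_right μ

theorem fourierCoef₂_eq [IsProbabilityMeasure μ] (hφ : BddOrthonormal μ φ) {F : α × α → ℝ}
    (hF : BddMeasurable F) (k l : ℕ) :
    fourierCoef₂ μ φ k l F =
      fourierCoef μ φ l fun y => fourierCoef μ φ k fun x => F (x, y) := by
  unfold fourierCoef₂ fourierCoef
  have hG : BddMeasurable fun p : α × α => F p * (φ k p.1 * φ l p.2) :=
    hF.mul (((hφ.bdd k).comp measurable_fst).mul ((hφ.bdd l).comp measurable_snd))
  rw [integral_prod_symm _ (hG.integrable _)]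
  simp_rw [← integral_mul_const, mul_assoc]

/-- Expand in x for fixed y, then expand each resulting coefficient, a function of y, in y. -/
theorem integral_sq_eq_fourierCoef₂ [IsProbabilityMeasure μ] (hφ : BddOrthonormal μ φ)
    {F : α × α → ℝ} (hF : BddMeasurable F) (n : ℕ) :
    ∫ p, F p ^ 2 ∂(μ.prod μ) =
      (∑ k ∈ Finset.range n, ∑ l ∈ Finset.range n, fourierCoef₂ μ φ k l F ^ 2) +
      (∫ y, fourierTail μ φ n (fun x => F (x, y)) ∂μ) +
      ∑ k ∈ Finset.range n,
        fourierTail μ φ n (fun y => fourierCoef μ φ k fun x => F (x, y)) := by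
  have hg k : BddMeasurable fun y => fourierCoef μ φ k fun x => F (x, y) :=
    hφ.fourierCoef_fst hF k
  have hn : BddMeasurable fun y => ∫ x, F (x, y) ^ 2 ∂μ := hF.swap.sq.integral_right μ
  rw [integral_prod_symm _ (hF.sq.integrable _)]
  simp_rw [fourierCoef₂_eq hφ hF]
  unfold fourierTail
  rw [integral_sub (hn.integrable μ) ((BddMeasurable.sum _ fun k => (hg k).sq).integrable μ),
    integral_finsetSum _ fun k _ => (hg k).sq.integrable μ, Finset.sum_sub_distrib]
  ring

/-- The partial projections in x and in y commute. With `R` the remainder of `F` after projecting in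
y, the left side is the squared norm of the x-projection of `R`, and the right side is the squared
norm of `R`. -/
theorem sum_fourierTail_fourierCoef_le [IsProbabilityMeasure μ] (hφ : BddOrthonormal μ φ)
    {F : α × α → ℝ} (hF : BddMeasurable F) (n : ℕ) :
    ∑ k ∈ Finset.range n, fourierTail μ φ n (fun y => fourierCoef μ φ k fun x => F (x, y)) ≤
      ∫ x, fourierTail μ φ n (fun y => F (x, y)) ∂μ := by
  have hg k : BddMeasurable fun y => fourierCoef μ φ k fun x => F (x, y) :=
    hφ.fourierCoef_fst hF k
  have hh l : BddMeasurable fun x => fourierCoef μ φ l fun y => F (x, y) :=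
    hφ.fourierCoef_snd hF l
  let R : α × α → ℝ := fun p =>
    F p - ∑ l ∈ Finset.range n, (fourierCoef μ φ l fun y => F (p.1, y)) * φ l p.2
  have hR : BddMeasurable R := hF.sub (.sum _ fun l =>
    ((hh l).comp measurable_fst).mul ((hφ.bdd l).comp measurable_snd))
  have hcoef k l : fourierCoef μ φ l (fun y => fourierCoef μ φ k fun x => F (x, y)) =
      fourierCoef μ φ k (fun x => fourierCoef μ φ l fun y => F (x, y)) := by
    rw [← fourierCoef₂_eq hφ hF]
    unfold fourierCoef₂ fourierCoef
    have hG : BddMeasurable fun p : α × α => F p * (φ k p.1 * φ l p.2) :=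
      hF.mul (((hφ.bdd k).comp measurable_fst).mul ((hφ.bdd l).comp measurable_snd))
    rw [integral_prod _ (hG.integrable _)]
    refine integral_congr_ae (Eventually.of_forall fun x => ?_)
    simp only
    rw [← integral_mul_const]
    exact integral_congr_ae (Eventually.of_forall fun y => by simp only; ring)
  have hRk k y : fourierCoef μ φ k (fun x => R (x, y)) =
      (fourierCoef μ φ k fun x => F (x, y)) - ∑ l ∈ Finset.range n,
        fourierCoef μ φ l (fun y => fourierCoef μ φ k fun x => F (x, y)) * φ l y := by
    have hFy : BddMeasurable fun x => F (x, y) := hF.comp (h := fun x => (x, y)) (by fun_prop)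
    have hs l : BddMeasurable fun x => (fourierCoef μ φ l fun y => F (x, y)) * φ l y :=
      (hh l).mul (.const _)
    simp only [R]
    rw [fourierCoef_sub hφ hFy (.sum _ hs)]
    congr 1
    rw [fourierCoef]
    simp_rw [Finset.sum_mul]
    rw [integral_finsetSum _ fun l _ => ((hs l).mul (hφ.bdd k)).integrable μ]
    refine Finset.sum_congr rfl fun l _ => ?_
    rw [hcoef, fourierCoef, ← integral_mul_const]
    exact integral_congr_ae (Eventually.of_forall fun x => by simp only; ring)
  calc ∑ k ∈ Finset.range n, fourierTail μ φ n (fun y => fourierCoef μ φ k fun x => F (x, y))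
      = ∫ y, ∑ k ∈ Finset.range n, fourierCoef μ φ k (fun x => R (x, y)) ^ 2 ∂μ := by
        rw [integral_finsetSum _ fun k _ => BddMeasurable.integrable
          (hφ.fourierCoef_fst hR k).sq μ]
        refine Finset.sum_congr rfl fun k _ => ?_
        rw [fourierTail_eq hφ (hg k)]
        simp_rw [hRk]
    _ ≤ ∫ y, ∫ x, R (x, y) ^ 2 ∂μ ∂μ := by
        refine integral_mono (BddMeasurable.integrable (.sum _ fun k =>
          (hφ.fourierCoef_fst hR k).sq) μ)
          ((hR.swap.sq.integral_right μ).integrable μ) fun y => ?_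
        have := fourierTail_nonneg hφ
          (hR.comp (h := fun x : α => (x, y)) (by fun_prop)) n
        simpa [fourierTail] using this
    _ = ∫ x, ∫ y, R (x, y) ^ 2 ∂μ ∂μ := by
        rw [← integral_prod_symm _ (hR.sq.integrable _), integral_prod _ (hR.sq.integrable _)]
    _ = ∫ x, fourierTail μ φ n (fun y => F (x, y)) ∂μ := by
        refine integral_congr_ae (Eventually.of_forall fun x => ?_)
        exact (fourierTail_eq hφ (hF.comp (h := fun y : α => (x, y)) (by fun_prop)) n).symm

theorem sum_fourierCoef₂_sq_le [IsProbabilityMeasure μ] (hφ : BddOrthonormal μ φ)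
    {F : α × α → ℝ} (hF : BddMeasurable F) (n : ℕ) :
    ∑ k ∈ Finset.range n, ∑ l ∈ Finset.range n, fourierCoef₂ μ φ k l F ^ 2 ≤
      ∫ p, F p ^ 2 ∂(μ.prod μ) := by
  rw [integral_sq_eq_fourierCoef₂ hφ hF n, add_assoc]
  refine le_add_of_nonneg_right (add_nonneg (integral_nonneg fun y => ?_)
    (Finset.sum_nonneg fun k _ => ?_))
  · exact fourierTail_nonneg hφ (hF.comp (h := fun x : α => (x, y)) (by fun_prop)) n
  · exact fourierTail_nonneg hφ
      (hφ.fourierCoef_fst hF k) n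

/-- Each of the two variables contributes one `t`, since `unitMeasure`-type probability measures
average a uniform bound to itself. -/
theorem integral_sq_le_of_fourierTail_le [IsProbabilityMeasure μ] (hφ : BddOrthonormal μ φ)
    {F : α × α → ℝ} (hF : BddMeasurable F) (n : ℕ) {t : ℝ}
    (hx : ∀ y, fourierTail μ φ n (fun x => F (x, y)) ≤ t)
    (hy : ∀ x, fourierTail μ φ n (fun y => F (x, y)) ≤ t) :
    ∫ p, F p ^ 2 ∂(μ.prod μ) ≤
      (∑ k ∈ Finset.range n, ∑ l ∈ Finset.range n, fourierCoef₂ μ φ k l F ^ 2) + 2 * t := by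
  have key {f : α → ℝ} (h0 : ∀ x, 0 ≤ f x) (h : ∀ x, f x ≤ t) : ∫ x, f x ∂μ ≤ t := by
    have := integral_mono_of_nonneg (μ := μ) (Eventually.of_forall h0) (integrable_const t)
      (Eventually.of_forall h)
    simpa using this
  rw [integral_sq_eq_fourierCoef₂ hφ hF n]
  have h1 := sum_fourierTail_fourierCoef_le hφ hF n
  have h2 := key (fun y => fourierTail_nonneg hφ
    (hF.comp (h := fun x : α => (x, y)) (by fun_prop)) n) hx
  have h3 := key (fun x => fourierTail_nonneg hφ
    (hF.comp (h := fun y : α => (x, y)) (by fun_prop)) n) hy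
  linarith

end Bessel


/-! ### Legendre polynomials as an orthonormal system -/

theorem linearIndependent_X_pow : LinearIndependent ℝ fun k : ℕ => (X : ℝ[X]) ^ k := by
  have h := (Polynomial.basisMonomials ℝ).linearIndependent
  simpa [Polynomial.coe_basisMonomials, Polynomial.X_pow_eq_monomial] using h

theorem integral_legendre_mul (k l : ℕ) :
    ∫ x in (0 : ℝ)..1, (legendre k).eval x * (legendre l).eval x = if k = l then 1 else 0 := by
  let _ : NormedAddCommGroup ℝ[X] := polyInnerCore.toNormedAddCommGroup
  let _ : InnerProductSpace ℝ ℝ[X] := InnerProductSpace.ofCore polyInnerCore.toCore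
  exact orthonormal_iff_ite.1
    (InnerProductSpace.gramSchmidtNormed_orthonormal linearIndependent_X_pow) k l

/-- Gram–Schmidt preserves the span, and the monomials span. This is the algebraic half of
completeness. -/
theorem span_range_legendre : Submodule.span ℝ (Set.range legendre) = ⊤ := by
  let _ : NormedAddCommGroup ℝ[X] := polyInnerCore.toNormedAddCommGroup
  let _ : InnerProductSpace ℝ ℝ[X] := InnerProductSpace.ofCore polyInnerCore.toCore
  have h1 : Submodule.span ℝ (Set.range legendre) =
      Submodule.span ℝ (Set.range fun k : ℕ => (X : ℝ[X]) ^ k) :=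
    (InnerProductSpace.span_gramSchmidtNormed_range _).trans
      (InnerProductSpace.span_gramSchmidt ℝ _)
  have h2 := (Polynomial.basisMonomials ℝ).span_eq
  rw [h1, ← h2]
  congr 2
  ext k : 1
  simp [Polynomial.X_pow_eq_monomial]

theorem exists_eq_sum_legendre (p : ℝ[X]) :
    ∃ (n : ℕ) (a : ℕ → ℝ), ∀ x, p.eval x = ∑ k ∈ Finset.range n, a k * (legendre k).eval x := by
  have hp : p ∈ Submodule.span ℝ (Set.range legendre) := by
    rw [span_range_legendre]; exact Submodule.mem_top
  obtain ⟨c, rfl⟩ := (Finsupp.mem_span_range_iff_exists_finsupp).1 hp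
  refine ⟨c.support.sup id + 1, c, fun x => ?_⟩
  rw [Finsupp.sum, eval_finsetSum]
  simp only [eval_smul, smul_eq_mul]
  refine Finset.sum_subset (fun k hk => ?_) fun k _ hk => ?_
  · exact Finset.mem_range.2 (Nat.lt_succ_of_le (Finset.le_sup (f := id) hk))
  · simp [Finsupp.notMem_support_iff.1 hk]

/-- Lebesgue measure on `[0,1]`. -/
noncomputable abbrev unitMeasure : Measure ℝ := volume.restrict (Set.Icc 0 1)

instance : IsProbabilityMeasure unitMeasure := ⟨by simp [unitMeasure]⟩

/-- The Legendre polynomials, cut off outside `[0,1]`. -/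
noncomputable def legendreFun (k : ℕ) : ℝ → ℝ :=
  (Set.Icc 0 1).indicator fun x => (legendre k).eval x

theorem legendreFun_of_mem {x : ℝ} (hx : x ∈ Set.Icc (0 : ℝ) 1) (k : ℕ) :
    legendreFun k x = (legendre k).eval x := Set.indicator_of_mem hx _

theorem bddMeasurable_indicator_Icc {f : ℝ → ℝ} (hf : Continuous f) :
    BddMeasurable ((Set.Icc 0 1).indicator f) := by
  refine ⟨hf.measurable.indicator measurableSet_Icc, ?_⟩
  obtain ⟨C, hC⟩ := (isCompact_Icc (a := (0 : ℝ)) (b := 1)).exists_bound_of_continuousOn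
    hf.continuousOn
  refine ⟨C, fun x => ?_⟩
  by_cases hx : x ∈ Set.Icc (0 : ℝ) 1
  · simpa [hx] using hC x hx
  · simpa [Set.indicator_of_notMem hx] using (norm_nonneg _).trans (hC 0 (by simp))

/-- The cut-off makes the polynomials globally bounded and is invisible to `unitMeasure`. -/
theorem bddOrthonormal_legendreFun : BddOrthonormal unitMeasure legendreFun where
  bdd k := bddMeasurable_indicator_Icc (legendre k).continuous
  ortho k l := by
    rw [← integral_legendre_mul, intervalIntegral.integral_of_le zero_le_one,
      ← integral_Icc_eq_integral_Ioc]
    refine setIntegral_congr_fun measurableSet_Icc fun x hx => ?_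
    simp only [legendreFun_of_mem hx]

/-! ### Uniform decay of the Fourier tails of interval indicators -/

/-- Completeness: approximate `f` in L² by a continuous function, that one uniformly by a polynomial
(Weierstrass), and use best approximation. Monotonicity passes from one degree to all larger ones.
-/
theorem tendsto_fourierTail_legendreFun {f : ℝ → ℝ} (hf : BddMeasurable f) :
    Tendsto (fun n => fourierTail unitMeasure legendreFun n f) atTop (𝓝 0) := by
  have hφ := bddOrthonormal_legendreFun
  refine tendsto_order.2 ⟨fun a ha => Eventually.of_forall fun n =>
    ha.trans_le (fourierTail_nonneg hφ hf n), fun ε hε => ?_⟩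
  have hmem : MemLp f (ENNReal.ofReal 2) unitMeasure := by
    obtain ⟨hm, C, hC⟩ := hf
    exact MemLp.of_bound hm.aestronglyMeasurable C (Eventually.of_forall hC)
  obtain ⟨g, -, hg, hgc, -⟩ := hmem.exists_hasCompactSupport_integral_rpow_sub_le two_pos
    (show 0 < ε / 8 by positivity)
  -- An error below both 1 and ε/8 has square at most ε/8; the total is then 2·ε/8 + 2·ε/8 < ε.
  obtain ⟨p, hp⟩ := exists_polynomial_near_of_continuousOn 0 1 g hgc.continuousOn
    (min 1 (ε / 8)) (by positivity)
  obtain ⟨n, a, ha⟩ := exists_eq_sum_legendre p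
  filter_upwards [eventually_ge_atTop n] with m hm
  refine lt_of_le_of_lt ((fourierTail_antitone f hm).trans (fourierTail_le hφ hf n a)) ?_
  have hgI := bddMeasurable_indicator_Icc hgc
  have hle : ∫ x, (f x - ∑ k ∈ Finset.range n, a k * legendreFun k x) ^ 2 ∂unitMeasure ≤
      ∫ x, (2 * (f x - (Set.Icc 0 1).indicator g x) ^ 2 + 2 * (ε / 8)) ∂unitMeasure := by
    refine integral_mono_ae
      ((hf.sub (.sum _ fun k => (BddMeasurable.const _).mul (hφ.bdd k))).sq.integrable _)
      (((BddMeasurable.const 2).mul (hf.sub hgI).sq).add (.const _) |>.integrable _) ?_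
    filter_upwards [ae_restrict_mem measurableSet_Icc] with x hx
    have h1 := hp x hx
    rw [ha x] at h1
    simp only [legendreFun_of_mem hx, Set.indicator_of_mem hx]
    set S := ∑ k ∈ Finset.range n, a k * (legendre k).eval x
    have h2 : (S - g x) ^ 2 ≤ ε / 8 := by
      rw [← sq_abs]
      have h3 := h1.le.trans (min_le_left _ _)
      have h4 := h1.le.trans (min_le_right _ _)
      nlinarith [abs_nonneg (S - g x)]
    nlinarith [sq_nonneg ((f x - g x) + (S - g x))]
  have hg' : ∫ x, (f x - (Set.Icc 0 1).indicator g x) ^ 2 ∂unitMeasure ≤ ε / 8 := by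
    refine le_trans (le_of_eq ?_) hg
    refine setIntegral_congr_fun measurableSet_Icc fun x hx => ?_
    simp [Set.indicator_of_mem hx]
  rw [integral_add (((BddMeasurable.const 2).mul (hf.sub hgI).sq).integrable _)
    (integrable_const _), integral_const_mul] at hle
  simp only [integral_const, probReal_univ, one_smul] at hle
  linarith

/-- The explicit form shows that the tail is continuous in the endpoints, as Dini's theorem
requires. -/
theorem fourierTail_indicator_Icc {a b : ℝ} (ha : 0 ≤ a) (hab : a ≤ b) (hb : b ≤ 1) (n : ℕ) :
    fourierTail unitMeasure legendreFun n ((Set.Icc a b).indicator fun _ => 1) =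
      (b - a) - ∑ k ∈ Finset.range n, (∫ x in a..b, (legendre k).eval x) ^ 2 := by
  have hsub : Set.Icc a b ⊆ Set.Icc 0 1 := Set.Icc_subset_Icc ha hb
  have hint (g : ℝ → ℝ) :
      ∫ x, (Set.Icc a b).indicator g x ∂unitMeasure = ∫ x in Set.Icc a b, g x := by
    rw [integral_indicator measurableSet_Icc, Measure.restrict_restrict measurableSet_Icc,
      Set.inter_eq_left.2 hsub]
  unfold fourierTail fourierCoef
  congr 1
  · have : ∀ x, (Set.Icc a b).indicator (fun _ => (1 : ℝ)) x ^ 2 =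
        (Set.Icc a b).indicator (fun _ => (1 : ℝ)) x := fun x => by
      by_cases hx : x ∈ Set.Icc a b <;> simp [hx]
    simp_rw [this]
    rw [hint]
    simp [hab]
  · refine Finset.sum_congr rfl fun k _ => ?_
    congr 1
    have : ∀ x, (Set.Icc a b).indicator (fun _ => (1 : ℝ)) x * legendreFun k x =
        (Set.Icc a b).indicator (fun x => (legendre k).eval x) x := fun x => by
      by_cases hx : x ∈ Set.Icc a b
      · simp [hx, legendreFun_of_mem (hsub hx)]
      · simp [Set.indicator_of_notMem hx]
    simp_rw [this]
    rw [hint, intervalIntegral.integral_of_le hab, integral_Icc_eq_integral_Ioc]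

/-- Dini: the tails are continuous in (a, b), decrease in n and tend to 0 pointwise on a compact
triangle. -/
theorem exists_fourierTail_indicator_Icc_le {ε : ℝ} (hε : 0 < ε) :
    ∃ n₀, ∀ n ≥ n₀, ∀ a b : ℝ, 0 ≤ a → a ≤ b → b ≤ 1 →
      fourierTail unitMeasure legendreFun n ((Set.Icc a b).indicator fun _ => 1) ≤ ε := by
  let s : Set (ℝ × ℝ) := {p | 0 ≤ p.1 ∧ p.1 ≤ p.2 ∧ p.2 ≤ 1}
  have hs : IsCompact s := by
    refine (isCompact_Icc (a := ((0 : ℝ), (0 : ℝ))) (b := (1, 1))).of_isClosed_subset ?_ ?_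
    · exact (isClosed_le continuous_const continuous_fst).inter
        ((isClosed_le continuous_fst continuous_snd).inter
          (isClosed_le continuous_snd continuous_const))
    · rintro ⟨x, y⟩ ⟨h1, h2, h3⟩
      exact ⟨⟨h1, h1.trans h2⟩, h2.trans h3, h3⟩
  have hunif := Antitone.tendstoUniformlyOn_of_forall_tendsto
    (F := fun n (p : ℝ × ℝ) =>
      fourierTail unitMeasure legendreFun n ((Set.Icc p.1 p.2).indicator fun _ => 1))
    (f := fun _ => (0 : ℝ)) hs ?_ (fun p _ => fourierTail_antitone _) continuousOn_const
    (fun p _ => tendsto_fourierTail_legendreFun (.indicator_one measurableSet_Icc))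
  · obtain ⟨n₀, hn₀⟩ := eventually_atTop.1 (Metric.tendstoUniformlyOn_iff.1 hunif ε hε)
    refine ⟨n₀, fun n hn a b ha hab hb => ?_⟩
    have := hn₀ n hn (a, b) ⟨ha, hab, hb⟩
    rw [dist_comm, Real.dist_eq, sub_zero] at this
    exact (le_abs_self _).trans this.le
  · intro n
    have hc : Continuous fun p : ℝ × ℝ => (p.2 - p.1) -
        ∑ k ∈ Finset.range n, (∫ x in p.1..p.2, (legendre k).eval x) ^ 2 := by
      refine (continuous_snd.sub continuous_fst).sub (continuous_finsetSum _ fun k _ => ?_)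
      refine Continuous.pow ?_ 2
      have hi (a b : ℝ) : IntervalIntegrable (fun x => (legendre k).eval x) volume a b :=
        (legendre k).continuous.intervalIntegrable _ _
      have h0 := intervalIntegral.continuous_primitive hi 0
      have : (fun p : ℝ × ℝ => ∫ x in p.1..p.2, (legendre k).eval x) = fun p =>
          (∫ x in (0 : ℝ)..p.2, (legendre k).eval x) -
            ∫ x in (0 : ℝ)..p.1, (legendre k).eval x := by
        ext p
        rw [intervalIntegral.integral_interval_sub_left (hi _ _) (hi _ _)]
      rw [this]
      exact (h0.comp continuous_snd).sub (h0.comp continuous_fst)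
    exact hc.continuousOn.congr fun p hp => fourierTail_indicator_Icc hp.1 hp.2.1 hp.2.2 n

/-! ### Compact convex subsets of the unit square -/

/-- A compact convex subset of the line is empty or a closed interval; this is where convexity
yields uniformity. -/
theorem exists_slice_fourierTail_le {ε : ℝ} (hε : 0 < ε) :
    ∃ n₀, ∀ n ≥ n₀, ∀ s : Set ℝ, s ⊆ Set.Icc 0 1 → IsCompact s → Convex ℝ s →
      fourierTail unitMeasure legendreFun n (s.indicator fun _ => 1) ≤ ε := by
  obtain ⟨n₀, hn₀⟩ := exists_fourierTail_indicator_Icc_le hε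
  refine ⟨n₀, fun n hn s hs hc hconv => ?_⟩
  rcases s.eq_empty_or_nonempty with rfl | hne
  · simp [fourierTail, fourierCoef, hε.le]
  · have hI : s = Set.Icc (sInf s) (sSup s) :=
      eq_Icc_of_connected_compact ⟨hne, hconv.isPreconnected⟩ hc
    have h1 := hs (hc.sInf_mem hne)
    have h2 := hs (hc.sSup_mem hne)
    rw [hI]
    exact hn₀ n hn _ _ h1.1 (csInf_le_csSup hne hc.bddBelow hc.bddAbove) h2.2

theorem prod_unitMeasure :
    unitMeasure.prod unitMeasure = (volume : Measure (ℝ × ℝ)).restrict unitSquare := by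
  rw [unitMeasure, Measure.prod_restrict]; rfl

theorem isCompact_unitSquare : IsCompact unitSquare := isCompact_Icc.prod isCompact_Icc

theorem fourierCoef₂_indicator {A : Set (ℝ × ℝ)} (hA : MeasurableSet A) (hAs : A ⊆ unitSquare)
    (k l : ℕ) :
    fourierCoef₂ unitMeasure legendreFun k l (A.indicator fun _ => 1) = legendreMoment k l A := by
  unfold fourierCoef₂ legendreMoment
  have : ∀ p, A.indicator (fun _ => (1 : ℝ)) p * (legendreFun k p.1 * legendreFun l p.2) =
      A.indicator (fun p => (legendre k).eval p.1 * (legendre l).eval p.2) p := fun p => by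
    by_cases hp : p ∈ A
    · simp [hp, legendreFun_of_mem (hAs hp).1, legendreFun_of_mem (hAs hp).2]
    · simp [Set.indicator_of_notMem hp]
  simp_rw [this]
  rw [prod_unitMeasure, integral_indicator hA, Measure.restrict_restrict hA,
    Set.inter_eq_left.2 hAs]

theorem fourierCoef₂_indicator_sub {A B : Set (ℝ × ℝ)} (hA : MeasurableSet A)
    (hB : MeasurableSet B) (hAs : A ⊆ unitSquare) (hBs : B ⊆ unitSquare) (k l : ℕ) :
    fourierCoef₂ unitMeasure legendreFun k l
      (fun p => A.indicator (fun _ => 1) p - B.indicator (fun _ => 1) p) =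
      legendreMoment k l A - legendreMoment k l B := by
  have hφ := bddOrthonormal_legendreFun
  rw [← fourierCoef₂_indicator hA hAs, ← fourierCoef₂_indicator hB hBs]
  have hL : BddMeasurable fun p : ℝ × ℝ => legendreFun k p.1 * legendreFun l p.2 :=
    ((hφ.bdd k).comp measurable_fst).mul ((hφ.bdd l).comp measurable_snd)
  unfold fourierCoef₂
  simp_rw [sub_mul]
  exact integral_sub (((BddMeasurable.indicator_one hA).mul hL).integrable _)
    (((BddMeasurable.indicator_one hB).mul hL).integrable _)

theorem integral_sq_indicator_sub {A B : Set (ℝ × ℝ)} (hA : MeasurableSet A)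
    (hB : MeasurableSet B) (hAs : A ⊆ unitSquare) (hBs : B ⊆ unitSquare) :
    ∫ p, (A.indicator (fun _ => (1 : ℝ)) p - B.indicator (fun _ => 1) p) ^ 2
      ∂(unitMeasure.prod unitMeasure) = nikodym A B := by
  have : ∀ p, (A.indicator (fun _ => (1 : ℝ)) p - B.indicator (fun _ => 1) p) ^ 2 =
      ((A \ B) ∪ (B \ A)).indicator (fun _ => 1) p := fun p => by
    by_cases h1 : p ∈ A <;> by_cases h2 : p ∈ B <;> simp [h1, h2]
  have hm : MeasurableSet ((A \ B) ∪ (B \ A)) := (hA.diff hB).union (hB.diff hA)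
  have hsub : (A \ B) ∪ (B \ A) ⊆ unitSquare :=
    Set.union_subset (Set.sdiff_subset.trans hAs) (Set.sdiff_subset.trans hBs)
  simp_rw [this]
  rw [prod_unitMeasure, integral_indicator hm, Measure.restrict_restrict hm,
    Set.inter_eq_left.2 hsub, nikodym]
  simp

/-- Bessel's inequality for the Legendre moments of two planar sets. -/
theorem sum_legendreMoment_sub_sq_le {A B : Set (ℝ × ℝ)} (hA : MeasurableSet A)
    (hB : MeasurableSet B) (hAs : A ⊆ unitSquare) (hBs : B ⊆ unitSquare) (n : ℕ) :
    ∑ k ∈ Finset.range n, ∑ l ∈ Finset.range n,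
      (legendreMoment k l A - legendreMoment k l B) ^ 2 ≤ nikodym A B := by
  have := sum_fourierCoef₂_sq_le bddOrthonormal_legendreFun
    ((BddMeasurable.indicator_one hA).sub (.indicator_one hB)) n
  simpa only [integral_sq_indicator_sub hA hB hAs hBs,
    fourierCoef₂_indicator_sub hA hB hAs hBs] using this

/-- The first `n²` Legendre moments determine a compact convex subset of the unit square up to an
error in the Nikodym distance that tends to zero uniformly. -/
theorem exists_nikodym_le_sum_legendreMoment {ε : ℝ} (hε : 0 < ε) :
    ∃ n₀, ∀ n ≥ n₀, ∀ A B : Set (ℝ × ℝ), A ⊆ unitSquare → B ⊆ unitSquare →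
      IsCompact A → IsCompact B → Convex ℝ A → Convex ℝ B →
      nikodym A B ≤ (∑ k ∈ Finset.range n, ∑ l ∈ Finset.range n,
        (legendreMoment k l A - legendreMoment k l B) ^ 2) + ε := by
  -- The slice tail of a difference is at most 2·ε/8 + 2·ε/8 = ε/2, and the two directions add up to
  -- ε.
  obtain ⟨n₀, hn₀⟩ := exists_slice_fourierTail_le (show 0 < ε / 8 by positivity)
  refine ⟨n₀, fun n hn A B hAs hBs hAc hBc hA hB => ?_⟩
  have hφ := bddOrthonormal_legendreFun
  have hAm := hAc.measurableSet
  have hBm := hBc.measurableSet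
  have slice_fst {A : Set (ℝ × ℝ)} (hAs : A ⊆ unitSquare) (hAc : IsCompact A) (hA : Convex ℝ A)
      (y : ℝ) : fourierTail unitMeasure legendreFun n
        (fun x => A.indicator (fun _ => 1) (x, y)) ≤ ε / 8 := by
    refine hn₀ n hn ((fun x => (x, y)) ⁻¹' A) (fun x hx => (hAs hx).1) ?_ ?_
    · exact isCompact_Icc.of_isClosed_subset
        (hAc.isClosed.preimage (f := fun x => (x, y)) (by fun_prop)) fun x hx => (hAs hx).1
    · intro x hx x' hx' a b ha hb hab
      have := hA hx hx' ha hb hab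
      simpa [← add_mul, hab] using this
  have slice_snd {A : Set (ℝ × ℝ)} (hAs : A ⊆ unitSquare) (hAc : IsCompact A) (hA : Convex ℝ A)
      (x : ℝ) : fourierTail unitMeasure legendreFun n
        (fun y => A.indicator (fun _ => 1) (x, y)) ≤ ε / 8 := by
    refine hn₀ n hn ((fun y => (x, y)) ⁻¹' A) (fun y hy => (hAs hy).2) ?_ ?_
    · exact isCompact_Icc.of_isClosed_subset
        (hAc.isClosed.preimage (f := fun y => (x, y)) (by fun_prop)) fun x hx => (hAs hx).2
    · intro y hy y' hy' a b ha hb hab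
      have := hA hy hy' ha hb hab
      simpa [← add_mul, hab] using this
  have hf {A : Set (ℝ × ℝ)} (hA : MeasurableSet A) (y : ℝ) :
      BddMeasurable fun x => A.indicator (fun _ => (1 : ℝ)) (x, y) :=
    (BddMeasurable.indicator_one hA).comp (h := fun x => (x, y)) (by fun_prop)
  have hs {A : Set (ℝ × ℝ)} (hA : MeasurableSet A) (x : ℝ) :
      BddMeasurable fun y => A.indicator (fun _ => (1 : ℝ)) (x, y) :=
    (BddMeasurable.indicator_one hA).comp (h := fun y => (x, y)) (by fun_prop)
  have := integral_sq_le_of_fourierTail_le hφ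
    ((BddMeasurable.indicator_one hAm).sub (.indicator_one hBm)) n (t := ε / 2)
    (fun y => (fourierTail_sub_le hφ (hf hAm y) (hf hBm y) n).trans (by
      linarith [slice_fst hAs hAc hA y, slice_fst hBs hBc hB y]))
    (fun x => (fourierTail_sub_le hφ (hs hAm x) (hs hBm x) n).trans (by
      linarith [slice_snd hAs hAc hA x, slice_snd hBs hBc hB x]))
  simp only [integral_sq_indicator_sub hAm hBm hAs hBs,
    fourierCoef₂_indicator_sub hAm hBm hAs hBs] at this
  linarith


/-! ### Polygons with prescribed normals -/

theorem continuous_dirInner : Continuous fun p : ℝ × (ℝ × ℝ) => dirInner p.1 p.2 := by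
  unfold dirInner; fun_prop

theorem continuous_dirInner_right (t : ℝ) : Continuous (dirInner t) := by
  unfold dirInner; fun_prop

theorem isClosed_polygon {n : ℕ} (θ h : Fin n → ℝ) : IsClosed (polygon θ h) := by
  simp only [polygon, Set.ofPred_forall]
  exact isClosed_iInter fun i =>
    isClosed_le (continuous_dirInner_right _) continuous_const

theorem convex_polygon {n : ℕ} (θ h : Fin n → ℝ) : Convex ℝ (polygon θ h) := by
  intro x hx y hy a b ha hb hab i
  have : dirInner (θ i) (a • x + b • y) = a * dirInner (θ i) x + b * dirInner (θ i) y := by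
    simp [dirInner]; ring
  rw [this]
  calc a * dirInner (θ i) x + b * dirInner (θ i) y ≤ a * h i + b * h i := by
        gcongr
        exacts [hx i, hy i]
    _ = h i := by rw [← add_mul, hab, one_mul]

theorem volume_dirInner_eq (t c : ℝ) : volume {x : ℝ × ℝ | dirInner t x = c} = 0 := by
  have hm : MeasurableSet {x : ℝ × ℝ | dirInner t x = c} :=
    (isClosed_eq (continuous_dirInner_right _) continuous_const).measurableSet
  rw [Measure.volume_eq_prod, Measure.measure_prod_null hm]
  rcases eq_or_ne (Real.sin t) 0 with hs | hs
  · have hc : Real.cos t ≠ 0 := fun hc => by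
      have := Real.sin_sq_add_cos_sq t
      simp [hs, hc] at this
    have hne : ∀ᵐ x : ℝ, x ≠ c / Real.cos t := by simp [ae_iff]
    filter_upwards [hne] with x hx
    have : Prod.mk x ⁻¹' {x : ℝ × ℝ | dirInner t x = c} = ∅ := by
      ext y
      simpa [dirInner, hs] using fun h => hx (eq_div_of_mul_eq hc h)
    simp [this]
  · refine Eventually.of_forall fun x => ?_
    refine measure_mono_null (t := {(c - x * Real.cos t) / Real.sin t}) (fun y hy => ?_) (by simp)
    have hy' : x * Real.cos t + y * Real.sin t = c := hy
    rw [Set.mem_singleton_iff, eq_div_iff hs]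
    linarith

theorem ae_dirInner_ne {n : ℕ} (θ h : Fin n → ℝ) :
    ∀ᵐ x : ℝ × ℝ, ∀ i, dirInner (θ i) x ≠ h i :=
  ae_all_iff.2 fun i => by simpa [ae_iff] using volume_dirInner_eq (θ i) (h i)

/-- Integrals over the part of a polygon in the unit square depend continuously on the support
numbers. -/
theorem continuous_integral_polygon {n : ℕ} (θ : Fin n → ℝ) {g : ℝ × ℝ → ℝ}
    (hg : IntegrableOn g unitSquare) :
    Continuous fun h : Fin n → ℝ => ∫ x in unitSquare, (polygon θ h).indicator g x := by
  refine continuous_iff_continuousAt.2 fun h => ?_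
  refine continuousAt_of_dominated (bound := fun x => ‖g x‖) (Eventually.of_forall fun h' => ?_)
    (Eventually.of_forall fun h' => Eventually.of_forall fun x => norm_indicator_le_norm_self _ _)
    hg.norm ?_
  · exact hg.aestronglyMeasurable.indicator (isClosed_polygon θ h').measurableSet
  -- Off the finitely many null boundary lines, membership in the polygon is locally constant in the
  -- support numbers.
  · filter_upwards [ae_restrict_of_ae (ae_dirInner_ne θ h)] with x hx
    by_cases hmem : x ∈ polygon θ h
    · have hev : ∀ᶠ h' : Fin n → ℝ in 𝓝 h, ∀ i, dirInner (θ i) x < h' i :=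
        eventually_all.2 fun i => (continuous_apply i).continuousAt.eventually
          (lt_mem_nhds (lt_of_le_of_ne (hmem i) (hx i)))
      refine (continuousAt_const (y := g x)).congr ?_
      filter_upwards [hev] with h' hh'
      exact (Set.indicator_of_mem (s := polygon θ h') (fun i => (hh' i).le) g).symm
    · obtain ⟨i, hi⟩ : ∃ i, h i < dirInner (θ i) x := by simpa [polygon] using hmem
      refine (continuousAt_const (y := (0 : ℝ))).congr ?_
      filter_upwards [(continuous_apply i).continuousAt.eventually (gt_mem_nhds hi)] with h' hh'
      exact (Set.indicator_of_notMem (s := polygon θ h') (fun hc => hh'.not_ge (hc i)) g).symm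

/-- Tuples of points of the unit square, the `i`-th of which is extremal in the `i`-th
direction. -/
def supportTuples {n : ℕ} (θ : Fin n → ℝ) : Set (Fin n → ℝ × ℝ) :=
  {v | (∀ i, v i ∈ unitSquare) ∧ ∀ i j, dirInner (θ j) (v i) ≤ dirInner (θ j) (v j)}

/-- The support numbers of a tuple of extremal points. -/
noncomputable def supportNumbers {n : ℕ} (θ : Fin n → ℝ) (v : Fin n → ℝ × ℝ) (i : Fin n) : ℝ :=
  dirInner (θ i) (v i)

theorem continuous_supportNumbers {n : ℕ} (θ : Fin n → ℝ) : Continuous (supportNumbers θ) :=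
  continuous_pi fun i =>
    continuous_dirInner.comp (continuous_const.prodMk (continuous_apply i))

theorem isCompact_supportTuples {n : ℕ} (θ : Fin n → ℝ) : IsCompact (supportTuples θ) := by
  refine (isCompact_univ_pi fun _ : Fin n => isCompact_unitSquare).of_isClosed_subset ?_
    fun v hv i _ => hv.1 i
  have hc (i j : Fin n) : Continuous fun v : Fin n → ℝ × ℝ => dirInner (θ j) (v i) :=
    continuous_dirInner.comp (continuous_const.prodMk (continuous_apply i))
  simp only [supportTuples, Set.ofPred_and, Set.ofPred_forall]
  exact (isClosed_iInter fun i => isCompact_unitSquare.isClosed.preimage (continuous_apply i)).inter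
    (isClosed_iInter fun i => isClosed_iInter fun j => isClosed_le (hc i j) (hc j j))

/-- The four coordinate directions occur among the angles. -/
def HasAxes {n : ℕ} (θ : Fin n → ℝ) : Prop :=
  (∃ i, θ i = 0) ∧ (∃ i, θ i = Real.pi / 2) ∧ (∃ i, θ i = Real.pi) ∧ ∃ i, θ i = 3 * Real.pi / 2

theorem polygon_subset_unitSquare {n : ℕ} {θ : Fin n → ℝ} (hθ : HasAxes θ) {v : Fin n → ℝ × ℝ}
    (hv : v ∈ supportTuples θ) : polygon θ (supportNumbers θ v) ⊆ unitSquare := by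
  obtain ⟨⟨i0, h0⟩, ⟨i1, h1⟩, ⟨i2, h2⟩, i3, h3⟩ := hθ
  intro x hx
  have hc : Real.cos (3 * Real.pi / 2) = 0 := by
    rw [show 3 * Real.pi / 2 = Real.pi / 2 + Real.pi by ring, Real.cos_add_pi,
      Real.cos_pi_div_two, neg_zero]
  have hs : Real.sin (3 * Real.pi / 2) = -1 := by
    rw [show 3 * Real.pi / 2 = Real.pi / 2 + Real.pi by ring, Real.sin_add_pi,
      Real.sin_pi_div_two]
  have e0 := hx i0
  have e1 := hx i1
  have e2 := hx i2
  have e3 := hx i3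
  simp only [supportNumbers, dirInner, h0, h1, h2, h3, hc, hs, Real.cos_zero, Real.sin_zero,
    Real.cos_pi_div_two, Real.sin_pi_div_two, Real.cos_pi, Real.sin_pi] at e0 e1 e2 e3
  have v0 := (hv.1 i0).1.2
  have v1 := (hv.1 i1).2.2
  have v2 := (hv.1 i2).1.1
  have v3 := (hv.1 i3).2.1
  exact ⟨⟨by linarith, by linarith⟩, by linarith, by linarith⟩

/-- A consistent polygon in the square is compact, so every support value is attained and the
maximizers form a tuple. Conversely the points of a tuple lie in its polygon and attain its support
numbers. -/
theorem polygonClass_eq_image {n : ℕ} {θ : Fin n → ℝ} (hθ : HasAxes θ) :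
    polygonClass θ = (fun v => polygon θ (supportNumbers θ v)) '' supportTuples θ := by
  ext P
  constructor
  · rintro ⟨h, hh, rfl, hP⟩
    have hcomp : IsCompact (polygon θ h) :=
      isCompact_unitSquare.of_isClosed_subset (isClosed_polygon θ h) hP
    -- The empty set has no least upper bound in ℝ, so consistency in a single direction suffices.
    have hne : (polygon θ h).Nonempty := by
      obtain ⟨i, -⟩ := hθ.1
      exact Set.image_nonempty.1 (hh i).nonempty
    have hmax (i : Fin n) : ∃ x ∈ polygon θ h, dirInner (θ i) x = h i :=
      (hh i).mem_of_isClosed (hne.image _)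
        (hcomp.image (continuous_dirInner_right _)).isClosed
    choose v hv hvh using hmax
    have e : supportNumbers θ v = h := funext hvh
    refine ⟨v, ⟨fun i => hP (hv i), fun i j => ?_⟩, by simp only [e]⟩
    rw [hvh j]
    exact hv i j
  · rintro ⟨v, hv, rfl⟩
    refine ⟨supportNumbers θ v, fun i => IsGreatest.isLUB ⟨⟨v i, fun j => hv.2 i j, rfl⟩, ?_⟩,
      rfl, polygon_subset_unitSquare hθ hv⟩
    rintro _ ⟨x, hx, rfl⟩
    exact hx i

theorem legendreMoment_polygon {n : ℕ} {θ h : Fin n → ℝ} (hP : polygon θ h ⊆ unitSquare)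
    (k l : ℕ) :
    legendreMoment k l (polygon θ h) = ∫ x in unitSquare,
      (polygon θ h).indicator (fun x => (legendre k).eval x.1 * (legendre l).eval x.2) x := by
  have hm := (isClosed_polygon θ h).measurableSet
  rw [integral_indicator hm, Measure.restrict_restrict hm, Set.inter_eq_left.2 hP]
  rfl

/-- Writing (1_K - 1_P)² = 1_K + 1_P (1 - 2·1_K) makes the distance affine in 1_P, so
`continuous_integral_polygon` applies. -/
theorem nikodym_polygon {n : ℕ} {θ h : Fin n → ℝ} (hP : polygon θ h ⊆ unitSquare)
    {K : Set (ℝ × ℝ)} (hK : MeasurableSet K) (hKs : K ⊆ unitSquare) :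
    nikodym K (polygon θ h) = (∫ x in unitSquare, K.indicator (fun _ => (1 : ℝ)) x) +
      ∫ x in unitSquare, (polygon θ h).indicator
        (fun x => 1 - 2 * K.indicator (fun _ => (1 : ℝ)) x) x := by
  have hm := (isClosed_polygon θ h).measurableSet
  have b1 := BddMeasurable.indicator_one hK
  have b2 := BddMeasurable.indicator_one hm
  rw [← integral_sq_indicator_sub hK hm hKs hP, ← prod_unitMeasure,
    ← integral_add (b1.integrable _)]
  · refine integral_congr_ae (Eventually.of_forall fun x => ?_)
    by_cases h1 : x ∈ K <;> by_cases h2 : x ∈ polygon θ h <;> simp [h1, h2]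
    norm_num
  · exact (((BddMeasurable.const 1).sub ((BddMeasurable.const 2).mul b1)).integrable _).indicator hm

theorem continuous_legendreMoment_integrand (k l : ℕ) :
    Continuous fun x : ℝ × ℝ => (legendre k).eval x.1 * (legendre l).eval x.2 :=
  ((legendre k).continuous.comp continuous_fst).mul ((legendre l).continuous.comp continuous_snd)

theorem continuousOn_legendreMoment {n : ℕ} {θ : Fin n → ℝ} (hθ : HasAxes θ) (k l : ℕ) :
    ContinuousOn (fun v => legendreMoment k l (polygon θ (supportNumbers θ v)))
      (supportTuples θ) :=
  ((continuous_integral_polygon θ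
    ((continuous_legendreMoment_integrand k l).continuousOn.integrableOn_compact
      isCompact_unitSquare)).comp (continuous_supportNumbers θ)).continuousOn.congr fun _ hv =>
      legendreMoment_polygon (polygon_subset_unitSquare hθ hv) k l

theorem continuousOn_nikodym {n : ℕ} {θ : Fin n → ℝ} (hθ : HasAxes θ) {K : Set (ℝ × ℝ)}
    (hK : MeasurableSet K) (hKs : K ⊆ unitSquare) :
    ContinuousOn (fun v => nikodym K (polygon θ (supportNumbers θ v))) (supportTuples θ) := by
  have hg : IntegrableOn (fun x => 1 - 2 * K.indicator (fun _ => (1 : ℝ)) x) unitSquare := by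
    rw [IntegrableOn, ← prod_unitMeasure]
    exact ((BddMeasurable.const 1).sub
      ((BddMeasurable.const 2).mul (.indicator_one hK))).integrable _
  exact (continuous_const.add ((continuous_integral_polygon θ hg).comp
    (continuous_supportNumbers θ))).continuousOn.congr fun _ hv =>
      nikodym_polygon (polygon_subset_unitSquare hθ hv) hK hKs

/-! ### Existence of estimators and measurability of the worst-case error -/

theorem exists_isMinOn_of_compact {X Y : Type*} [TopologicalSpace X] [CompactSpace X] [Nonempty X]
    [TopologicalSpace Y] {J : Y → X → ℝ} (hJ : Continuous fun p : Y × X => J p.1 p.2) (y : Y) :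
    ∃ v, ∀ w, J y v ≤ J y w := by
  have : Continuous (J y) := hJ.comp (continuous_const.prodMk continuous_id)
  obtain ⟨v, -, hv⟩ := isCompact_univ.exists_isMinOn Set.univ_nonempty this.continuousOn
  exact ⟨v, fun w => hv (Set.mem_univ w)⟩

/-- The largest value of a continuous function on the set of minimizers of a parametrized
continuous function on a compact space is a Borel function of the parameter. -/
theorem measurable_sSup_image_minimizers {X Y : Type*} [TopologicalSpace X] [CompactSpace X]
    [Nonempty X] [TopologicalSpace Y] [MeasurableSpace Y] [BorelSpace Y] {J : Y → X → ℝ}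
    (hJ : Continuous fun p : Y × X => J p.1 p.2) {g : X → ℝ} (hg : Continuous g) :
    Measurable fun y => sSup (g '' {v | ∀ w, J y v ≤ J y w}) := by
  refine measurable_of_Ici fun c => IsClosed.measurableSet ?_
  -- The minimizers form a nonempty compact set, so the supremum is attained and the superlevel set
  -- is a projection; projecting along a compact factor preserves closedness.
  have hset : (fun y => sSup (g '' {v | ∀ w, J y v ≤ J y w})) ⁻¹' Set.Ici c =
      Prod.fst '' {p : Y × X | (∀ w, J p.1 p.2 ≤ J p.1 w) ∧ c ≤ g p.2} := by
    ext y
    have hcl : IsClosed {v | ∀ w, J y v ≤ J y w} := by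
      simp only [Set.ofPred_forall]
      exact isClosed_iInter fun w =>
        isClosed_le (hJ.comp (continuous_const.prodMk continuous_id)) continuous_const
    have hcomp : IsCompact (g '' {v | ∀ w, J y v ≤ J y w}) := hcl.isCompact.image hg
    simp only [Set.mem_preimage, Set.mem_Ici, Set.mem_image, Prod.exists, exists_and_right,
      exists_eq_right]
    constructor
    · intro hc
      obtain ⟨v, hv, hgv⟩ := hcomp.sSup_mem (Set.Nonempty.image g (exists_isMinOn_of_compact hJ y))
      exact ⟨v, hv, hc.trans_eq hgv.symm⟩
    · rintro ⟨v, hv, hcv⟩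
      exact hcv.trans (le_csSup hcomp.bddAbove ⟨v, hv, rfl⟩)
  rw [hset]
  refine isClosedMap_fst_of_compactSpace _ ?_
  simp only [Set.ofPred_and, Set.ofPred_forall]
  exact (isClosed_iInter fun w => isClosed_le hJ
    (hJ.comp (continuous_fst.prodMk continuous_const))).inter
    (isClosed_le continuous_const (hg.comp continuous_snd))

section Estimators

variable {n : ℕ} {θ : Fin n → ℝ}

/-- The least squares objective as a function of the measurements and the extremal points. -/
noncomputable def tupleObjective (θ : Fin n → ℝ) (N : ℕ) (y : ℕ → ℕ → ℝ) (v : supportTuples θ) :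
    ℝ :=
  lsqObjective N y (polygon θ (supportNumbers θ v))

theorem continuous_tupleObjective (hθ : HasAxes θ) (N : ℕ) :
    Continuous fun p : (ℕ → ℕ → ℝ) × supportTuples θ => tupleObjective θ N p.1 p.2 := by
  unfold tupleObjective lsqObjective
  refine continuous_finsetSum _ fun k _ => continuous_finsetSum _ fun l _ => ?_
  have h1 : Continuous fun p : (ℕ → ℕ → ℝ) × supportTuples θ => p.1 k l := by fun_prop
  have h2 : Continuous fun p : (ℕ → ℕ → ℝ) × supportTuples θ =>
      legendreMoment k l (polygon θ (supportNumbers θ p.2)) :=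
    (continuousOn_iff_continuous_domRestrict.1 (continuousOn_legendreMoment hθ k l)).comp
      continuous_snd
  exact (h1.sub h2).pow 2

theorem lsqEstimators_eq_image (hθ : HasAxes θ) (N : ℕ) (y : ℕ → ℕ → ℝ) :
    lsqEstimators θ N y = (fun v : supportTuples θ => polygon θ (supportNumbers θ v)) ''
      {v | ∀ w, tupleObjective θ N y v ≤ tupleObjective θ N y w} := by
  ext P
  simp only [lsqEstimators, polygonClass_eq_image hθ, tupleObjective]
  constructor
  · rintro ⟨⟨v, hv, rfl⟩, hP⟩
    exact ⟨⟨v, hv⟩, fun w => hP _ ⟨w, w.2, rfl⟩, rfl⟩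
  · rintro ⟨v, hv, rfl⟩
    refine ⟨⟨v, v.2, rfl⟩, ?_⟩
    rintro _ ⟨w, hw, rfl⟩
    exact hv ⟨w, hw⟩

theorem nonempty_supportTuples (θ : Fin n → ℝ) : Nonempty (supportTuples θ) :=
  ⟨⟨fun _ => (0, 0), fun _ => by simp [unitSquare], fun _ _ => le_rfl⟩⟩

theorem lsqEstimators_nonempty (hθ : HasAxes θ) (N : ℕ) (y : ℕ → ℕ → ℝ) :
    (lsqEstimators θ N y).Nonempty := by
  have := nonempty_supportTuples θ
  have := isCompact_iff_compactSpace.1 (isCompact_supportTuples θ)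
  rw [lsqEstimators_eq_image hθ]
  exact Set.Nonempty.image _ (exists_isMinOn_of_compact (continuous_tupleObjective hθ N) y)

theorem measurable_sSup_nikodym (hθ : HasAxes θ) {K : Set (ℝ × ℝ)} (hK : MeasurableSet K)
    (hKs : K ⊆ unitSquare) (N : ℕ) :
    Measurable fun y : ℕ → ℕ → ℝ => sSup (nikodym K '' lsqEstimators θ N y) := by
  have := nonempty_supportTuples θ
  have := isCompact_iff_compactSpace.1 (isCompact_supportTuples θ)
  have h := measurable_sSup_image_minimizers (continuous_tupleObjective hθ N)
    (continuousOn_iff_continuous_domRestrict.1 (continuousOn_nikodym hθ hK hKs))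
  convert h using 3 with y
  rw [lsqEstimators_eq_image hθ, Set.image_image]
  rfl

end Estimators

/-! ### Circumscribed polygons -/

/-- Strict separation from a compact set survives a small rotation of the normal, so a direction
from the dense sequence works. -/
theorem exists_dirInner_lt {K : Set (ℝ × ℝ)} (hK : IsCompact K) (hconv : Convex ℝ K)
    {θ : ℕ → ℝ} (hθ : Set.Ico 0 (2 * Real.pi) ⊆ closure (Set.range θ))
    {x : ℝ × ℝ} (hx : x ∉ K) : ∃ i, ∀ a ∈ K, dirInner (θ i) a < dirInner (θ i) x := by
  obtain ⟨f, u, hfK, hfx⟩ := geometric_hahn_banach_closed_point hconv hK.isClosed hx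
  let z : ℂ := ⟨f (1, 0), f (0, 1)⟩
  have hf (a : ℝ × ℝ) : f a = ‖z‖ * dirInner z.arg a := by
    have e : a = a.1 • ((1 : ℝ), (0 : ℝ)) + a.2 • ((0 : ℝ), (1 : ℝ)) := by ext <;> simp
    have e1 : ‖z‖ * Real.cos z.arg = f (1, 0) := Complex.norm_mul_cos_arg z
    have e2 : ‖z‖ * Real.sin z.arg = f (0, 1) := Complex.norm_mul_sin_arg z
    conv_lhs => rw [e, map_add, map_smul, map_smul, ← e1, ← e2]
    simp only [dirInner, smul_eq_mul]
    ring
  have hlt (a) (ha : a ∈ K) : dirInner z.arg a < dirInner z.arg x := by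
    have h := (hfK a ha).trans hfx
    rw [hf, hf] at h
    exact lt_of_mul_lt_mul_left h (norm_nonneg z)
  -- `Complex.arg` takes values in (-π, π], whereas density is assumed on [0, 2π).
  have hper (a : ℝ × ℝ) : dirInner (toIcoMod Real.two_pi_pos 0 z.arg) a = dirInner z.arg a := by
    simp only [dirInner, toIcoMod, zsmul_eq_mul]
    rw [Real.cos_sub_int_mul_two_pi, Real.sin_sub_int_mul_two_pi]
  set t := toIcoMod Real.two_pi_pos 0 z.arg
  have ht : t ∈ Set.Ico 0 (2 * Real.pi) := by
    simpa using toIcoMod_mem_Ico Real.two_pi_pos 0 z.arg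
  have hev : ∀ᶠ s in 𝓝 t, ∀ a ∈ K, dirInner s a < dirInner s x := by
    refine hK.eventually_forall_of_forall_eventually fun a ha => ?_
    have hopen : IsOpen {p : ℝ × (ℝ × ℝ) | dirInner p.1 p.2 < dirInner p.1 x} :=
      isOpen_lt continuous_dirInner
        (continuous_dirInner.comp (continuous_fst.prodMk continuous_const))
    exact hopen.mem_nhds (by simpa [hper] using hlt a ha)
  obtain ⟨_, hs, i, rfl⟩ := mem_closure_iff_nhds.1 (hθ ht) _ hev
  exact ⟨i, hs⟩

/-- A convex body in the unit square is the limit of circumscribed polygons with normals from a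
dense sequence of directions. -/
theorem exists_polygonClass_tendsto {K : Set (ℝ × ℝ)} (hK : IsCompact K) (hconv : Convex ℝ K)
    (hne : K.Nonempty) (hKs : K ⊆ unitSquare) {θ : ℕ → ℝ}
    (hθ : Set.Ico 0 (2 * Real.pi) ⊆ closure (Set.range θ))
    (haxes : ∀ n ≥ 4, HasAxes fun i : Fin n => θ i) :
    ∃ Q : ℕ → Set (ℝ × ℝ), (∀ n ≥ 4, Q n ∈ polygonClass fun i : Fin n => θ i) ∧
      Tendsto (fun n => nikodym K (Q n)) atTop (𝓝 0) := by
  have hmax (i : ℕ) : ∃ v ∈ K, ∀ x ∈ K, dirInner (θ i) x ≤ dirInner (θ i) v :=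
    hK.exists_isMaxOn hne (continuous_dirInner_right _).continuousOn
  choose v hvK hv using hmax
  let Q (n : ℕ) : Set (ℝ × ℝ) :=
    polygon (fun i : Fin n => θ i) (supportNumbers (fun i : Fin n => θ i) fun i => v i)
  have hmem (n : ℕ) : (fun i : Fin n => v i) ∈ supportTuples fun i : Fin n => θ i :=
    ⟨fun i => hKs (hvK i), fun i j => hv j _ (hvK i)⟩
  have hKQ (n : ℕ) : K ⊆ Q n := fun x hx i => hv i x hx
  have hQs (n : ℕ) (hn : 4 ≤ n) : Q n ⊆ unitSquare :=
    polygon_subset_unitSquare (haxes n hn) (hmem n)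
  refine ⟨Q, fun n hn => ?_, ?_⟩
  · rw [polygonClass_eq_image (haxes n hn)]
    exact ⟨_, hmem n, rfl⟩
  · have hnik (n : ℕ) : nikodym K (Q n) = volume.real (Q n \ K) := by
      rw [nikodym, Set.sdiff_eq_empty.2 (hKQ n), Set.empty_union]
    have hinter : ⋂ n, Q n \ K = ∅ := by
      refine Set.eq_empty_iff_forall_notMem.2 fun x hx => ?_
      rw [Set.mem_iInter] at hx
      obtain ⟨i, hi⟩ := exists_dirInner_lt hK hconv hθ (hx 0).2
      -- Direction `i` is first imposed on `Q (i + 1)`, and there `Q` uses a support point of `K`.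
      exact ((hx (i + 1)).1 ⟨i, i.lt_succ_self⟩).not_gt (hi _ (hvK i))
    have hanti : Antitone fun n => Q n \ K := fun m n hmn x hx =>
      ⟨fun i => hx.1 (Fin.castLE hmn i), hx.2⟩
    have hfin : volume (Q 4 \ K) ≠ ⊤ :=
      ((measure_mono (Set.sdiff_subset.trans (hQs 4 le_rfl))).trans_lt
        isCompact_unitSquare.measure_lt_top).ne
    have h := tendsto_measure_iInter_atTop (μ := volume)
      (fun n => ((isClosed_polygon _ _).measurableSet.diff hK.measurableSet).nullMeasurableSet)
      hanti ⟨4, hfin⟩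
    rw [hinter, measure_empty] at h
    simp_rw [hnik]
    exact (ENNReal.tendsto_toReal ENNReal.zero_ne_top).comp h


/-! ### Deterministic error bounds -/

theorem nikodym_nonneg (A B : Set (ℝ × ℝ)) : 0 ≤ nikodym A B := measureReal_nonneg

theorem nikodym_le {A B : Set (ℝ × ℝ)} (hA : A ⊆ unitSquare) (hB : B ⊆ unitSquare) :
    nikodym A B ≤ volume.real unitSquare :=
  measureReal_mono (Set.union_subset (Set.sdiff_subset.trans hA) (Set.sdiff_subset.trans hB))
    isCompact_unitSquare.measure_lt_top.ne

theorem worstError_nonneg (K : Set (ℝ × ℝ)) (θ : ℕ → ℝ) (n N : ℕ) (e : ℕ → ℕ → ℝ) :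
    0 ≤ worstError K θ n N e :=
  Real.sSup_nonneg <| by
    rintro _ ⟨P, -, rfl⟩
    exact nikodym_nonneg K P

/-- The condition `0 ≤ c` covers an empty set of estimators, since `sSup ∅ = 0` in ℝ. -/
theorem worstError_le {K : Set (ℝ × ℝ)} {θ : ℕ → ℝ} {n N : ℕ} {e : ℕ → ℕ → ℝ} {c : ℝ}
    (hc : 0 ≤ c) (h : ∀ P ∈ lsqEstimators (fun i : Fin n => θ i) N (noisyMoments K e),
      nikodym K P ≤ c) : worstError K θ n N e ≤ c :=
  Real.sSup_le (by rintro _ ⟨P, hP, rfl⟩; exact h P hP) hc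

/-- The sum of the squares of the first `(N+1)²` measurement errors. -/
noncomputable def sqNoise (N : ℕ) (e : ℕ → ℕ → ℝ) : ℝ :=
  ∑ k ∈ Finset.range (N + 1), ∑ l ∈ Finset.range (N + 1), e k l ^ 2

theorem sqNoise_nonneg (N : ℕ) (e : ℕ → ℕ → ℝ) : 0 ≤ sqNoise N e :=
  Finset.sum_nonneg fun _ _ => Finset.sum_nonneg fun _ _ => sq_nonneg _

/-- Removing the noise at `P`, using minimality, and inserting the noise at `Q` each use (a + b)² ≤
2a² + 2b² or nothing: 2(2Σ + 2S) + 2S = 4Σ + 6S. -/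
theorem sum_legendreMoment_sub_sq_le_of_mem_lsqEstimators {n N : ℕ} {θ : Fin n → ℝ}
    {K P Q : Set (ℝ × ℝ)} {e : ℕ → ℕ → ℝ} (hP : P ∈ lsqEstimators θ N (noisyMoments K e))
    (hQ : Q ∈ polygonClass θ) :
    ∑ k ∈ Finset.range (N + 1), ∑ l ∈ Finset.range (N + 1),
        (legendreMoment k l K - legendreMoment k l P) ^ 2 ≤
      4 * (∑ k ∈ Finset.range (N + 1), ∑ l ∈ Finset.range (N + 1),
        (legendreMoment k l K - legendreMoment k l Q) ^ 2) + 6 * sqNoise N e := by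
  have h := hP.2 Q hQ
  have h1 : ∑ k ∈ Finset.range (N + 1), ∑ l ∈ Finset.range (N + 1),
        (legendreMoment k l K - legendreMoment k l P) ^ 2 ≤
      2 * lsqObjective N (noisyMoments K e) P + 2 * sqNoise N e := by
    simp only [lsqObjective, noisyMoments, sqNoise, Finset.mul_sum, ← Finset.sum_add_distrib]
    refine Finset.sum_le_sum fun k _ => Finset.sum_le_sum fun l _ => ?_
    nlinarith [sq_nonneg (legendreMoment k l K - legendreMoment k l P + 2 * e k l)]
  have h2 : lsqObjective N (noisyMoments K e) Q ≤
      2 * (∑ k ∈ Finset.range (N + 1), ∑ l ∈ Finset.range (N + 1),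
        (legendreMoment k l K - legendreMoment k l Q) ^ 2) + 2 * sqNoise N e := by
    simp only [lsqObjective, noisyMoments, sqNoise, Finset.mul_sum, ← Finset.sum_add_distrib]
    refine Finset.sum_le_sum fun k _ => Finset.sum_le_sum fun l _ => ?_
    nlinarith [sq_nonneg (legendreMoment k l K - legendreMoment k l Q - e k l)]
  linarith

theorem exists_worstError_le {K : Set (ℝ × ℝ)} (hK : IsCompact K) (hconv : Convex ℝ K)
    (hKs : K ⊆ unitSquare) (θ : ℕ → ℝ) {ε : ℝ} (hε : 0 < ε) :
    ∃ N₀, ∀ N ≥ N₀, ∀ n, ∀ e : ℕ → ℕ → ℝ, ∀ Q ∈ polygonClass (fun i : Fin n => θ i),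
      worstError K θ n N e ≤ 4 * nikodym K Q + 6 * sqNoise N e + ε := by
  obtain ⟨N₀, hN₀⟩ := exists_nikodym_le_sum_legendreMoment hε
  refine ⟨N₀, fun N hN n e Q hQ => ?_⟩
  have hclass {P : Set (ℝ × ℝ)} (hP : P ∈ polygonClass (fun i : Fin n => θ i)) :
      P ⊆ unitSquare ∧ IsCompact P ∧ Convex ℝ P := by
    obtain ⟨h, -, rfl, hs⟩ := hP
    exact ⟨hs, isCompact_unitSquare.of_isClosed_subset (isClosed_polygon _ h) hs,
      convex_polygon _ h⟩
  refine worstError_le ?_ fun P hP => ?_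
  · have := nikodym_nonneg K Q
    have := sqNoise_nonneg N e
    positivity
  · obtain ⟨hPs, hPc, hPconv⟩ := hclass hP.1
    obtain ⟨hQs, hQc, -⟩ := hclass hQ
    have h1 := hN₀ (N + 1) (by omega) K P hKs hPs hK hPc hconv hPconv
    have h2 := sum_legendreMoment_sub_sq_le_of_mem_lsqEstimators hP hQ
    have h3 := sum_legendreMoment_sub_sq_le hK.measurableSet hQc.measurableSet hKs hQs (N + 1)
    linarith

/-- Serves both modes of convergence: `f` is the expected error in (i) and the error on a fixed path
in (ii). -/
theorem tendsto_zero_of_le_add {f : ℕ × ℕ → ℝ} {δ s : ℕ → ℝ} (hf : ∀ p, 0 ≤ f p)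
    (hδ : Tendsto δ atTop (𝓝 0)) (hs : Tendsto s atTop (𝓝 0))
    (h : ∀ ε > 0, ∃ N₀, ∀ N ≥ N₀, ∀ n ≥ 4, f (n, N) ≤ 4 * δ n + 6 * s N + ε) :
    Tendsto f atTop (𝓝 0) := by
  refine tendsto_order.2 ⟨fun a ha => Eventually.of_forall fun p => ha.trans_le (hf p),
    fun ε hε => ?_⟩
  obtain ⟨N₀, hN₀⟩ := h (ε / 3) (by positivity)
  have h1 : ∀ᶠ n in atTop, 4 * δ n < ε / 3 :=
    (by simpa using hδ.const_mul 4 : Tendsto (fun n => 4 * δ n) atTop (𝓝 0)).eventually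
      (gt_mem_nhds (by positivity))
  have h2 : ∀ᶠ N in atTop, 6 * s N < ε / 3 :=
    (by simpa using hs.const_mul 6 : Tendsto (fun n => 6 * s n) atTop (𝓝 0)).eventually
      (gt_mem_nhds (by positivity))
  rw [← prod_atTop_atTop_eq]
  filter_upwards [(h1.and (eventually_ge_atTop 4)).prod_mk (h2.and (eventually_ge_atTop N₀))]
    with p hp
  have := hN₀ p.2 hp.2.2 p.1 hp.1.2
  linarith [hp.1.1, hp.2.1]

/-! ### Random measurements -/

section Random

variable {Ω : Type*} [MeasurableSpace Ω] {μ : Measure Ω}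

theorem measurable_worstError {K : Set (ℝ × ℝ)} (hK : MeasurableSet K) (hKs : K ⊆ unitSquare)
    {θ : ℕ → ℝ} {n : ℕ} (hθ : HasAxes fun i : Fin n => θ i) {N : ℕ} {e : ℕ → ℕ → Ω → ℝ}
    (he : ∀ k ≤ N, ∀ l ≤ N, Measurable (e k l)) :
    Measurable fun ω => worstError K θ n N fun k l => e k l ω := by
  -- Only the noise with indices at most `N` is known to be measurable; the objective reads no other
  -- entries, so they are set to 0.
  let y (ω : Ω) (k l : ℕ) : ℝ :=
    if k ≤ N ∧ l ≤ N then legendreMoment k l K + e k l ω else 0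
  have hy : Measurable y := by
    refine measurable_pi_lambda _ fun k => measurable_pi_lambda _ fun l => ?_
    by_cases h : k ≤ N ∧ l ≤ N
    · simpa [y, h] using (he k h.1 l h.2).const_add (legendreMoment k l K)
    · simp [y, h]
  convert (measurable_sSup_nikodym hθ hK hKs N).comp hy using 1
  ext ω
  have hobj (P : Set (ℝ × ℝ)) :
      lsqObjective N (noisyMoments K fun k l => e k l ω) P = lsqObjective N (y ω) P := by
    refine Finset.sum_congr rfl fun k hk => Finset.sum_congr rfl fun l hl => ?_
    have hk' := Nat.lt_succ_iff.1 (Finset.mem_range.1 hk)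
    have hl' := Nat.lt_succ_iff.1 (Finset.mem_range.1 hl)
    simp [noisyMoments, y, hk', hl']
  simp only [worstError, lsqEstimators, hobj, Function.comp]

theorem integrable_worstError [IsFiniteMeasure μ] {K : Set (ℝ × ℝ)} (hKs : K ⊆ unitSquare)
    {θ : ℕ → ℝ} {n N : ℕ} {e : ℕ → ℕ → Ω → ℝ}
    (hm : Measurable fun ω => worstError K θ n N fun k l => e k l ω) :
    Integrable (fun ω => worstError K θ n N fun k l => e k l ω) μ := by
  refine Integrable.of_bound hm.aestronglyMeasurable (volume.real unitSquare)
    (Eventually.of_forall fun ω => ?_)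
  rw [Real.norm_of_nonneg (worstError_nonneg _ _ _ _ _)]
  refine worstError_le measureReal_nonneg fun P hP => nikodym_le hKs ?_
  obtain ⟨h, -, rfl, hs⟩ := hP.1
  exact hs

theorem integrable_sqNoise {N : ℕ} {e : ℕ → ℕ → Ω → ℝ}
    (hL2 : ∀ k ≤ N, ∀ l ≤ N, MemLp (e k l) 2 μ) :
    Integrable (fun ω => sqNoise N fun k l => e k l ω) μ :=
  integrable_finsetSum _ fun k hk => integrable_finsetSum _ fun l hl =>
    (hL2 k (Nat.lt_succ_iff.1 (Finset.mem_range.1 hk)) l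
      (Nat.lt_succ_iff.1 (Finset.mem_range.1 hl))).integrable_sq

/-- Mean zero turns each second moment into a variance, and there are (N+1)² of them; linearity
needs no independence. -/
theorem integral_sqNoise_le {N : ℕ} {e : ℕ → ℕ → Ω → ℝ} {v : ℝ}
    (hL2 : ∀ k ≤ N, ∀ l ≤ N, MemLp (e k l) 2 μ)
    (hmean : ∀ k ≤ N, ∀ l ≤ N, ∫ ω, e k l ω ∂μ = 0)
    (hvar : ∀ k ≤ N, ∀ l ≤ N, variance (e k l) μ ≤ v) :
    ∫ ω, sqNoise N (fun k l => e k l ω) ∂μ ≤ ((N : ℝ) + 1) ^ 2 * v := by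
  have hr {k : ℕ} (hk : k ∈ Finset.range (N + 1)) : k ≤ N :=
    Nat.lt_succ_iff.1 (Finset.mem_range.1 hk)
  unfold sqNoise
  rw [integral_finsetSum _ fun k hk => integrable_finsetSum _ fun l hl =>
    (hL2 k (hr hk) l (hr hl)).integrable_sq]
  calc _ ≤ ∑ k ∈ Finset.range (N + 1), ∑ l ∈ Finset.range (N + 1), v := by
        refine Finset.sum_le_sum fun k hk => ?_
        rw [integral_finsetSum _ fun l hl => (hL2 k (hr hk) l (hr hl)).integrable_sq]
        refine Finset.sum_le_sum fun l hl => ?_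
        rw [← variance_of_integral_eq_zero (hL2 k (hr hk) l (hr hl)).aemeasurable
          (hmean k (hr hk) l (hr hl))]
        exact hvar k (hr hk) l (hr hl)
    _ = ((N : ℝ) + 1) ^ 2 * v := by simp; ring

/-- A sequence of nonnegative random variables with summable expectations tends to zero almost
surely. -/
theorem ae_tendsto_zero_of_summable_integral {X : ℕ → Ω → ℝ} (hX : ∀ N, Integrable (X N) μ)
    (hnn : ∀ N ω, 0 ≤ X N ω) (hsum : Summable fun N => ∫ ω, X N ω ∂μ) :
    ∀ᵐ ω ∂μ, Tendsto (fun N => X N ω) atTop (𝓝 0) := by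
  have hae N : AEMeasurable (fun ω => ENNReal.ofReal (X N ω)) μ :=
    (hX N).aestronglyMeasurable.aemeasurable.ennreal_ofReal
  -- By Tonelli the whole series has finite expectation, hence converges almost surely, and its
  -- terms tend to 0.
  have hfin : ∫⁻ ω, ∑' N, ENNReal.ofReal (X N ω) ∂μ ≠ ⊤ := by
    rw [lintegral_tsum hae]
    simp_rw [← ofReal_integral_eq_lintegral_ofReal (hX _) (Eventually.of_forall (hnn _))]
    exact hsum.tsum_ofReal_ne_top
  filter_upwards [ae_lt_top' (AEMeasurable.tsum hae) hfin] with ω hω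
  have h := (ENNReal.tendsto_toReal ENNReal.zero_ne_top).comp
    (ENNReal.tendsto_atTop_zero_of_tsum_ne_top hω.ne)
  simpa [Function.comp_def, ENNReal.toReal_ofReal (hnn _ ω)] using h

/-- The number of moments costs two powers of N. Part (i) takes r = ε, which gives decay; part (ii)
takes r = 1 + ε, which gives summability. -/
theorem isBigO_succ_sq_mul {a : ℕ → ℝ} {r : ℝ}
    (ha : a =O[atTop] fun N : ℕ => 1 / (N : ℝ) ^ (2 + r)) :
    (fun N : ℕ => ((N : ℝ) + 1) ^ 2 * a N) =O[atTop] fun N : ℕ => (N : ℝ) ^ (-r) := by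
  have h1 : (fun N : ℕ => ((N : ℝ) + 1) ^ 2) =O[atTop] fun N : ℕ => (N : ℝ) ^ 2 := by
    refine IsBigO.of_bound 4 ?_
    filter_upwards [eventually_ge_atTop 1] with N hN
    have : (1 : ℝ) ≤ N := by exact_mod_cast hN
    rw [Real.norm_of_nonneg (by positivity), Real.norm_of_nonneg (by positivity)]
    nlinarith
  refine (h1.mul ha).congr' EventuallyEq.rfl ?_
  filter_upwards [eventually_ge_atTop 1] with N hN
  have hN' : (0 : ℝ) < N := by exact_mod_cast hN
  rw [Real.rpow_add hN', Real.rpow_neg hN'.le, Real.rpow_two]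
  field_simp

/-- Markov's inequality. Integrability is required only eventually because it is available only for
n ≥ 4. -/
theorem tendstoInMeasure_zero_of_tendsto_integral [IsFiniteMeasure μ] {ι : Type*} {l : Filter ι}
    {X : ι → Ω → ℝ} (hX : ∀ᶠ i in l, Integrable (X i) μ)
    (h : Tendsto (fun i => ∫ ω, |X i ω| ∂μ) l (𝓝 0)) :
    TendstoInMeasure μ X l fun _ => 0 := by
  refine tendstoInMeasure_iff_norm.2 fun ε hε => ?_
  have h0 : Tendsto (fun i => μ.real {ω | ε ≤ ‖X i ω - 0‖}) l (𝓝 0) := by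
    refine squeeze_zero' (Eventually.of_forall fun i => measureReal_nonneg) ?_
      (by simpa using h.const_mul ε⁻¹ : Tendsto (fun i => ε⁻¹ * ∫ ω, |X i ω| ∂μ) l (𝓝 0))
    filter_upwards [hX] with i hi
    rw [← div_eq_inv_mul, le_div_iff₀ hε, mul_comm]
    simpa using mul_meas_ge_le_integral_of_nonneg
      (Eventually.of_forall fun ω => abs_nonneg (X i ω)) hi.abs ε
  simpa [Measure.real, Function.comp_def] using
    (ENNReal.continuous_ofReal.tendsto 0).comp h0

end Random

end LegendreRecon

theorem mainTheorem9 {Ω : Type*} [MeasurableSpace Ω] (μ : Measure Ω) [IsProbabilityMeasure μ]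
    (K : Set (ℝ × ℝ)) (hK : IsConvexBody K) (hKsub : K ⊆ unitSquare)
    (θ : ℕ → ℝ) (hθmem : ∀ i, θ i ∈ Set.Ico 0 (2 * Real.pi))
    (hθdense : Set.Ico 0 (2 * Real.pi) ⊆ closure (Set.range θ))
    (hθinj : Function.Injective θ)
    (hθ0 : θ 0 = 0) (hθ1 : θ 1 = Real.pi / 2) (hθ2 : θ 2 = Real.pi)
    (hθ3 : θ 3 = 3 * Real.pi / 2)
    (σ : ℕ → ℝ) (noise : ℕ → ℕ → ℕ → Ω → ℝ)
    (hmeas : ∀ N, ∀ k ≤ N, ∀ l ≤ N, Measurable (noise N k l))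
    (hL2 : ∀ N, ∀ k ≤ N, ∀ l ≤ N, MemLp (noise N k l) 2 μ)
    (hmean : ∀ N, ∀ k ≤ N, ∀ l ≤ N, ∫ ω, noise N k l ω ∂μ = 0)
    (hvar : ∀ N, ∀ k ≤ N, ∀ l ≤ N, variance (noise N k l) μ ≤ σ N ^ 2) :
    -- for `n ≥ 4`, estimators exist and the worst-case error is a random variable
    (∀ n ≥ 4, ∀ N,
      (∀ ω, (lsqEstimators (fun i : Fin n => θ i) N
        (noisyMoments K (fun k l => noise N k l ω))).Nonempty) ∧
      Measurable (fun ω => worstError K θ n N (fun k l => noise N k l ω))) ∧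
    -- (i) convergence in mean and in probability
    ((∃ ε : ℝ, 0 < ε ∧ (fun N => σ N ^ 2) =O[atTop] (fun N : ℕ => 1 / (N : ℝ) ^ (2 + ε))) →
      (∀ n ≥ 4, ∀ N, Integrable (fun ω => worstError K θ n N (fun k l => noise N k l ω)) μ) ∧
      Tendsto (fun p : ℕ × ℕ => ∫ ω, |worstError K θ p.1 p.2 (fun k l => noise p.2 k l ω)| ∂μ)
        atTop (𝓝 0) ∧
      TendstoInMeasure μ
        (fun (p : ℕ × ℕ) ω => worstError K θ p.1 p.2 (fun k l => noise p.2 k l ω))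
        atTop (fun _ => 0)) ∧
    -- (ii) almost sure convergence
    ((∃ ε : ℝ, 0 < ε ∧ (fun N => σ N ^ 2) =O[atTop] (fun N : ℕ => 1 / (N : ℝ) ^ (3 + ε))) →
      ∀ᵐ ω ∂μ, Tendsto (fun p : ℕ × ℕ => worstError K θ p.1 p.2 (fun k l => noise p.2 k l ω))
        atTop (𝓝 0)) := by
  have haxes : ∀ n ≥ 4, HasAxes fun i : Fin n => θ i := fun n hn =>
    ⟨⟨⟨0, by omega⟩, hθ0⟩, ⟨⟨1, by omega⟩, hθ1⟩, ⟨⟨2, by omega⟩, hθ2⟩, ⟨⟨3, by omega⟩, hθ3⟩⟩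
  obtain ⟨hKc, hKconv, hKint⟩ := hK
  have hKm := hKc.measurableSet
  have hD : ∀ n ≥ 4, ∀ N, Measurable fun ω => worstError K θ n N fun k l => noise N k l ω :=
    fun n hn N => measurable_worstError hKm hKsub (haxes n hn) (hmeas N)
  have hDint : ∀ n ≥ 4, ∀ N,
      Integrable (fun ω => worstError K θ n N fun k l => noise N k l ω) μ :=
    fun n hn N => integrable_worstError hKsub (hD n hn N)
  have hnn : ∀ n N e, 0 ≤ worstError K θ n N e := fun n N e => worstError_nonneg K θ n N e
  have hSint := fun N => integrable_sqNoise (hL2 N)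
  have hSle := fun N => integral_sqNoise_le (hL2 N) (hmean N) (hvar N)
  obtain ⟨Q, hQ, hQlim⟩ := exists_polygonClass_tendsto hKc hKconv
    (hKint.mono interior_subset) hKsub hθdense haxes
  refine ⟨fun n hn N => ⟨fun ω => lsqEstimators_nonempty (haxes n hn) N _, hD n hn N⟩, ?_, ?_⟩
  · rintro ⟨ε, hε, hσ⟩
    have hs : Tendsto (fun N : ℕ => ((N : ℝ) + 1) ^ 2 * σ N ^ 2) atTop (𝓝 0) :=
      (isBigO_succ_sq_mul hσ).trans_tendsto
        ((tendsto_rpow_neg_atTop hε).comp tendsto_natCast_atTop_atTop)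
    have hlim : Tendsto
        (fun p : ℕ × ℕ => ∫ ω, |worstError K θ p.1 p.2 (fun k l => noise p.2 k l ω)| ∂μ)
        atTop (𝓝 0) := by
      refine tendsto_zero_of_le_add (fun p => integral_nonneg fun ω => abs_nonneg _) hQlim hs
        fun η hη => ?_
      obtain ⟨N₀, hN₀⟩ := exists_worstError_le hKc hKconv hKsub θ hη
      refine ⟨N₀, fun N hN n hn => ?_⟩
      simp only [abs_of_nonneg (hnn _ _ _)]
      have hI : Integrable
          (fun ω => 4 * nikodym K (Q n) + 6 * sqNoise N fun k l => noise N k l ω) μ :=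
        (integrable_const _).add ((hSint N).const_mul 6)
      have hle := integral_mono (hDint n hn N) (hI.add (integrable_const η))
        fun ω => hN₀ N hN n _ (Q n) (hQ n hn)
      simp only [Pi.add_apply] at hle
      rw [integral_add hI (integrable_const _),
        integral_add (integrable_const _) ((hSint N).const_mul 6)] at hle
      simp only [integral_const, probReal_univ, one_smul, integral_const_mul] at hle
      linarith [hSle N]
    refine ⟨hDint, hlim, tendstoInMeasure_zero_of_tendsto_integral ?_ hlim⟩
    rw [← prod_atTop_atTop_eq]
    filter_upwards [(eventually_ge_atTop 4).prod_inl (atTop : Filter ℕ)] with p hp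
    exact hDint p.1 hp p.2
  · rintro ⟨ε, hε, hσ⟩
    have hbig : (fun N : ℕ => ((N : ℝ) + 1) ^ 2 * σ N ^ 2) =O[atTop]
        fun N : ℕ => (N : ℝ) ^ (-(1 + ε)) := by
      refine isBigO_succ_sq_mul ?_
      rwa [← add_assoc, show (2 : ℝ) + 1 = 3 by norm_num]
    have hsum : Summable fun N : ℕ => ((N : ℝ) + 1) ^ 2 * σ N ^ 2 :=
      summable_of_isBigO_nat (Real.summable_nat_rpow.2 (by linarith)) hbig
    have hsum' := Summable.of_nonneg_of_le
      (fun N => integral_nonneg fun ω => sqNoise_nonneg N fun k l => noise N k l ω) hSle hsum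
    -- The exceptional null set depends on the noise alone, so one path serves all `n` and all
    -- tolerances.
    filter_upwards [ae_tendsto_zero_of_summable_integral hSint
      (fun N ω => sqNoise_nonneg N _) hsum'] with ω hω
    refine tendsto_zero_of_le_add (fun p => hnn _ _ _) hQlim hω fun η hη => ?_
    obtain ⟨N₀, hN₀⟩ := exists_worstError_le hKc hKconv hKsub θ hη
    exact ⟨N₀, fun N hN n hn => hN₀ N hN n _ (Q n) (hQ n hn)⟩
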